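/- Let $K$ be an algebraically closed field and let $A=KQ/I$ be a finite-dimensional bound quiver algebra ($I$ an admissible ideal) whose set of vertices $\Lambda=Q_0$ carries a partial order $\leqslant$. For $i\in\Lambda$ let $e_i$ be the idempotent at $i$, $P(i)=Ae_i$ the indecomposable projective left module, $S(i)$ its top, $I(i)$ the indecomposable injective module with socle $S(i)$, $\Delta(i)$ the largest factor module of $P(i)$ all of whose composition factors are of the form $S(k)$ with $k\leqslant i$, and $\nabla(i)$ the $K$-dual of the standard $A^{op}$-module at $i$ (formed with the same order). A path from $i$ to $j$ is regarded as an element of $e_jAe_i$. Assume that $(A,\leqslant)$ is $1$-quasi-hereditary, that is: for all $i,k\in\Lambda$ one has $[\Delta(i):S(i)]=1$, the module $P(i)$ has a filtration with subquotients isomorphic to standard modules, $(P(i):\Delta(i))=1$, and $(P(i):\Delta(k))=0$ whenever $k\not\geqslant i$ (so $A$ is quasi-hereditary); moreover 1. $(\Lambda,\leqslant)$ has a smallest element, denoted $1$, and a largest element, denoted $n$; 2. $[\Delta(i):S(j)]=(P(j):\Delta(i))=1$ for all $j\leqslant i$; 3. $\operatorname{soc}P(j)\cong\operatorname{top}I(j)\cong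 S(1)$ for all $j$; 4. for every $i$ there are an injective $A$-map $\Delta(i)\to\Delta(n)$ and a surjective $A$-map $\nabla(n)\to\nabla(i)$. Let $B=\operatorname{End}_A(P(1))^{op}$, with product $F\circ G$ (first $G$, then $F$), so that $P(1)$ is a left $B$-module by evaluation. For $i\in\Lambda$, a path of the form $p(1,i,1)$ is a path $1\to\lambda_1\to\cdots\to\lambda_m\to i\to\mu_1\to\cdots\to\mu_r\to 1$ in $Q$ with $1\leqslant\lambda_1\leqslant\cdots\leqslant\lambda_m\leqslant i$ and $i\geqslant\mu_1\geqslant\cdots\geqslant\mu_r\geqslant 1$ (either half may be a trivial path if $i=1$). Then for every $i\in\Lambda$ a path of the form $p(1,i,1)$ exists. Choose, for every $i\in\Lambda$, any such path $p(1,i,1)$, and let $\mathfrak f_{(1,i,1)}\in B$ be the endomorphism of $P(1)$ with $e_1\mapsto p(1,i,1)$. Then there is an isomorphism of left $B$-modules $${}_BP(1)\;\cong\;\bigoplus_{i\in\Lambda}B\circ\mathfrak f_{(1,i,1)},$$ and for every $i\in\Lambda$ the left ideal $B\circ\mathfrak f_{(1,i,1)}$ is a two-sided ideal of $B$, it is local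 as a left $B$-module (its radical is a maximal submodule and the only one), and $$\operatorname{rad}\bigl(B\circ\mathfrak f_{(1,i,1)}\bigr)=\sum_{i<i'}B\circ\mathfrak f_{(1,i',1)} .$$ -/

import Mathlib

open scoped DirectSum

namespace OneQH

universe u v w x

/-! ### Bound quiver algebras -/

section BoundQuiver

variable {Λ : Type x} {A : Type v} [Ring A]

/-- The element of `A` attached to a path, given the images `e i` of the trivial paths and the
images `arr a` of the arrows. Paths are composed from right to left: first `p`, then `a`,
gives the product `a * p`. -/
def pathValue (Q : Quiver.{w} Λ) (e : Λ → A) (arr : ∀ i j : Λ, Q.Hom i j → A) {i : Λ} :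
    ∀ {j : Λ}, @Quiver.Path Λ Q i j → A
  | _, @Quiver.Path.nil _ _ _ => e i
  | _, @Quiver.Path.cons _ _ _ b c p a => arr b c a * pathValue Q e arr p

/-- All paths of a quiver. They form the standard basis of the path algebra. -/
abbrev AllPaths (Q : Quiver.{w} Λ) : Type (max x w) :=
  Σ i j : Λ, @Quiver.Path Λ Q i j

/-- The linear map from the path algebra `KQ` (the space with basis all paths) to `A`. -/
noncomputable def pathMap (K : Type u) [Field K] [Algebra K A] (Q : Quiver.{w} Λ) (e : Λ → A)
    (arr : ∀ i j : Λ, Q.Hom i j → A) : (AllPaths Q →₀ K) →ₗ[K] A :=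
  Finsupp.linearCombination K fun p : AllPaths Q => pathValue Q e arr p.2.2

/-- A presentation `A = KQ/I` of a `K`-algebra `A` by a quiver `Q` with vertex set `Λ` and an
admissible ideal `I`. The first two conditions on `e` and `arr` say that `pathMap` is a
homomorphism of algebras `KQ → A`; it is onto, and its kernel `I` satisfies
`R ^ m ⊆ I ⊆ R ^ 2` for some `m`, where `R` is the ideal of `KQ` generated by the arrows. -/
structure Presentation (K : Type u) [Field K] (A : Type v) [Ring A] [Algebra K A]
    (Λ : Type x) [Fintype Λ] where
  quiver : Quiver.{w} Λ
  e : Λ → A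
  arr : ∀ i j : Λ, quiver.Hom i j → A
  idem : CompleteOrthogonalIdempotents e
  arr_mem : ∀ (i j : Λ) (a : quiver.Hom i j), e j * arr i j a * e i = arr i j a
  surjective : Function.Surjective (pathMap K quiver e arr)
  ker_le : LinearMap.ker (pathMap K quiver e arr) ≤
    Finsupp.supported K K {p : AllPaths quiver | 2 ≤ @Quiver.Path.length Λ quiver _ _ p.2.2}
  nilpotent : ∃ m : ℕ, ∀ p : AllPaths quiver,
    m ≤ @Quiver.Path.length Λ quiver _ _ p.2.2 → pathValue quiver e arr p.2.2 = 0

end BoundQuiver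

/-! ### Projective, simple and standard modules, filtrations -/

section Modules

variable {R : Type v} [Ring R] {Λ : Type x}

/-- The projective module `P(i) = R e_i`. -/
abbrev proj (e : Λ → R) (i : Λ) : Submodule R R := Submodule.span R {e i}

/-- The top `M / rad M` of a module (of finite length). -/
abbrev Top (R : Type v) [Ring R] (M : Type w) [AddCommGroup M] [Module R M] : Type w :=
  M ⧸ Module.jacobson R M

/-- The socle: the sum of all simple submodules. -/
def socle (R : Type v) [Ring R] (M : Type w) [AddCommGroup M] [Module R M] : Submodule R M :=
  sSup {N : Submodule R M | IsSimpleModule R N}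

/-- The simple module `S(i)`, the top of `P(i)`. -/
abbrev simple (e : Λ → R) (i : Λ) : Type v := Top R (proj e i)

/-- `M` has a finite filtration in which every subquotient is isomorphic to some `X k`, and
`X k` is used for exactly `d k` of the subquotients. -/
def HasFiltration (X : Λ → Type w) [∀ k, AddCommGroup (X k)] [∀ k, Module R (X k)]
    (M : Type u) [AddCommGroup M] [Module R M] (d : Λ → ℕ) : Prop :=
  ∃ (r : ℕ) (N : Fin (r + 1) → Submodule R M) (σ : Fin r → Λ),
    N 0 = ⊥ ∧ N (Fin.last r) = ⊤ ∧ (∀ t : Fin r, N t.castSucc ≤ N t.succ) ∧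
    (∀ t : Fin r,
      Nonempty ((↥(N t.succ) ⧸ (N t.castSucc).submoduleOf (N t.succ)) ≃ₗ[R] X (σ t))) ∧
    ∀ k : Λ, d k = Nat.card {t : Fin r // σ t = k}

/-- `M` has a filtration by the modules `X` in which `X k` occurs `m` times. For the simple
modules `X = S` this says `[M : S(k)] = m`, for the standard modules `X = Δ` it says that `M` is
`Δ`-good with `(M : Δ(k)) = m`. -/
def HasMult (R : Type v) [Ring R] (X : Λ → Type w) [∀ k, AddCommGroup (X k)]
    [∀ k, Module R (X k)] (M : Type u) [AddCommGroup M] [Module R M] (k : Λ) (m : ℕ) : Prop :=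
  ∃ d : Λ → ℕ, HasFiltration (R := R) X M d ∧ d k = m

/-- The smallest submodule `U` of `P(i)` such that `[P(i)/U : S(k)] = 0` for all `k ≰ i`. -/
def stdKer [PartialOrder Λ] (e : Λ → R) (i : Λ) : Submodule R (proj e i) :=
  sInf {U | ∀ k : Λ, ¬ k ≤ i → HasMult R (simple e) (↥(proj e i) ⧸ U) k 0}

/-- The standard module `Δ(i)`: the largest factor module of `P(i)` all of whose composition
factors are of the form `S(k)` with `k ≤ i`. -/
abbrev std [PartialOrder Λ] (e : Λ → R) (i : Λ) : Type v := ↥(proj e i) ⧸ stdKer e i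

end Modules

/-! ### Duality, injective and costandard modules -/

section Dual

variable (K : Type u) [Field K] {A : Type v} [Ring A] [Algebra K A] {Λ : Type x}

/-- The standard dual `Hom_K(N, K)` of a (left) `Aᵐᵒᵖ`-module `N`, as a left `A`-module with
`(a φ)(x) = φ (x a)`. -/
def StdDual (_A : Type v) (N : Type w) [AddCommGroup N] [Module K N] : Type (max u w) :=
  N →ₗ[K] K

variable (A) (N : Type w) [AddCommGroup N] [Module K N]

instance : AddCommGroup (StdDual K A N) := inferInstanceAs (AddCommGroup (N →ₗ[K] K))

instance [Module Aᵐᵒᵖ N] [IsScalarTower K Aᵐᵒᵖ N] : Module A (StdDual K A N) where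
  smul a φ := LinearMap.comp (show N →ₗ[K] K from φ) (Algebra.lsmul K K N (MulOpposite.op a))
  one_smul φ := LinearMap.ext fun y =>
    congrArg (show N →ₗ[K] K from φ) (one_smul Aᵐᵒᵖ y)
  mul_smul a b φ := LinearMap.ext fun y =>
    congrArg (show N →ₗ[K] K from φ) (mul_smul (MulOpposite.op b) (MulOpposite.op a) y)
  smul_zero _ := rfl
  smul_add _ _ _ := rfl
  add_smul a b φ := LinearMap.ext fun y =>
    (congrArg (show N →ₗ[K] K from φ)
      (add_smul (MulOpposite.op a) (MulOpposite.op b) y)).trans (map_add _ _ _)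
  zero_smul φ := LinearMap.ext fun y =>
    (congrArg (show N →ₗ[K] K from φ) (zero_smul Aᵐᵒᵖ y)).trans (map_zero _)

variable {A}

/-- The idempotents of the opposite algebra. -/
abbrev opIdem (e : Λ → A) : Λ → Aᵐᵒᵖ := fun i => MulOpposite.op (e i)

/-- The injective module `I(i)`, the dual of the projective `Aᵐᵒᵖ`-module at `i`. -/
abbrev inj (e : Λ → A) (i : Λ) : Type (max u v) := StdDual K A (proj (opIdem e) i)

/-- The costandard module `∇(i)`, the dual of the standard `Aᵐᵒᵖ`-module at `i`. -/
abbrev costd [PartialOrder Λ] (e : Λ → A) (i : Λ) : Type (max u v) :=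
  StdDual K A (std (opIdem e) i)

end Dual

/-! ### Quasi-hereditary and 1-quasi-hereditary algebras -/

section QuasiHereditary

variable {A : Type v} [Ring A] {Λ : Type x} [PartialOrder Λ]

/-- `A`, with the idempotents `e i` and the partial order on `Λ`, is quasi-hereditary. -/
structure IsQuasiHereditary (e : Λ → A) : Prop where
  std_self : ∀ i : Λ, HasMult A (simple e) (std e i) i 1
  proj_not_ge : ∀ i k : Λ, ¬ i ≤ k → HasMult A (std e) (proj e i) k 0
  proj_self : ∀ i : Λ, HasMult A (std e) (proj e i) i 1

/-- `A`, with the idempotents `e i` and the partial order on `Λ`, is 1-quasi-hereditary. That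
there are a smallest element `⊥` and a largest element `⊤` is expressed by `BoundedOrder Λ`. -/
structure IsOneQuasiHereditary (K : Type u) [Field K] [Algebra K A] [BoundedOrder Λ]
    (e : Λ → A) : Prop extends IsQuasiHereditary e where
  std_mult : ∀ i j : Λ, j ≤ i → HasMult A (simple e) (std e i) j 1
  proj_mult : ∀ i j : Λ, j ≤ i → HasMult A (std e) (proj e j) i 1
  socle_proj : ∀ j : Λ, Nonempty (↥(socle A (proj e j)) ≃ₗ[A] simple e ⊥)
  top_inj : ∀ j : Λ, Nonempty (Top A (inj K e j) ≃ₗ[A] simple e ⊥)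
  std_embeds : ∀ i : Λ, ∃ g : std e i →ₗ[A] std e ⊤, Function.Injective g
  costd_surjects : ∀ i : Λ, ∃ g : costd K e ⊤ →ₗ[A] costd K e i, Function.Surjective g

end QuasiHereditary

/-! ### Paths and the endomorphisms they define -/

section Monotone

variable {Λ : Type x} [LE Λ]

/-- The path `j → ⋯ → k` runs through vertices that increase weakly. -/
def IsAscending (Q : Quiver.{w} Λ) {j : Λ} : ∀ {k : Λ}, @Quiver.Path Λ Q j k → Prop
  | _, @Quiver.Path.nil _ _ _ => True
  | _, @Quiver.Path.cons _ _ _ b c p _ => IsAscending Q p ∧ b ≤ c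

/-- The path `j → ⋯ → k` runs through vertices that decrease weakly. -/
def IsDescending (Q : Quiver.{w} Λ) {j : Λ} : ∀ {k : Λ}, @Quiver.Path Λ Q j k → Prop
  | _, @Quiver.Path.nil _ _ _ => True
  | _, @Quiver.Path.cons _ _ _ b c p _ => IsDescending Q p ∧ c ≤ b

end Monotone

section Paths

variable {K : Type u} [Field K] {A : Type v} [Ring A] [Algebra K A] {Λ : Type x} [Fintype Λ]

namespace Presentation

variable (D : Presentation.{u, v, w, x} K A Λ)

/-- Paths from `i` to `j` in the quiver of `A`. -/
abbrev Path (i j : Λ) : Type (max x w) := @Quiver.Path Λ D.quiver i j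

/-- The residue class in `A` of a path. -/
def value {i j : Λ} (p : D.Path i j) : A := pathValue D.quiver D.e D.arr p

theorem value_mul_e {i j : Λ} (p : D.Path i j) : D.value p * D.e i = D.value p := by
  unfold value
  induction p with
  | nil => exact D.idem.idem i
  | cons p a ih => simp only [pathValue, mul_assoc, ih]

theorem value_mem {i j : Λ} (p : D.Path i j) : D.value p ∈ proj D.e i :=
  Submodule.mem_span_singleton.2 ⟨D.value p, D.value_mul_e p⟩

/-- The `A`-map `P(k) → P(j)` with `e k ↦ p` attached to a path `p` from `j` to `k`. -/
def pathHom {j k : Λ} (p : D.Path j k) : proj D.e k →ₗ[A] proj D.e j :=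
  (LinearMap.toSpanSingleton A (proj D.e j) ⟨D.value p, D.value_mem p⟩).comp
    (proj D.e k).subtype

/-- `c` is a path of the form `p(j, i, k)`: an ascending path from `j` to `i` followed by a
descending path from `i` to `k`. -/
def IsPeakPath [PartialOrder Λ] (j i k : Λ) (c : D.Path j k) : Prop :=
  ∃ (p : D.Path j i) (q : D.Path i k), IsAscending D.quiver p ∧ IsDescending D.quiver q ∧
    c = @Quiver.Path.comp Λ D.quiver j i k p q

/-- The algebra `B = End_A(P(j))`, written `End_A(P(j))^op` when endomorphisms of left modules are
composed from left to right. Its product is `F * G = F ∘ G`, and `P(j)` is a left `B`-module by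
evaluation. -/
abbrev EndAlg (j : Λ) : Type v := Module.End A (proj D.e j)

/-- The left ideal `B ∘ f` of `B = End_A(P(j))`, where `f` is the endomorphism given by the
path `c` from `j` to `j`. -/
abbrev pathIdeal {j : Λ} (c : D.Path j j) : Ideal (D.EndAlg j) :=
  Ideal.span {(D.pathHom c : D.EndAlg j)}

end Presentation

end Paths

/-- `M` is a local module: `rad M` is a maximal submodule, and it is the only one. -/
def IsLocalModule (R : Type v) [Ring R] (M : Type w) [AddCommGroup M] [Module R M] : Prop :=
  ∀ N : Submodule R M, IsCoatom N ↔ N = Module.jacobson R M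

end OneQH

/-! Write e_i for `D.e i`. Endomorphisms of P(⊥) are right multiplications by elements of e_⊥Ae_⊥,
so B∘f_i corresponds to the right ideal d_i u_i e_⊥Ae_⊥, where u_i and d_i are the values of the
ascending and descending halves of the chosen path.

The axioms provide spanning vectors v_i and w_i of the lines e_iAe_⊤ and e_⊤Ae_i
(`exists_isPeakSystem`). A path starting at i is descending exactly when its value does not kill v_i
from the left, and a path ending at i is ascending exactly when w_i does not kill its value
(`value_mul_v_ne_zero_iff`, `w_mul_value_ne_zero_iff`). Only d_i v_i ≠ 0 and w_i u_i ≠ 0 matter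
afterwards, so the choice of paths is irrelevant.

An element of e_kAe_i killed by v_i factors through vertices above i, and dually for w_i. Hence,
modulo products through larger vertices, e_⊥Ae_i · e_iAe_⊥ is spanned by d_i u_i. Downward
induction, together with the count of common upper bounds for dim e_kAe_j, shows that the d_m u_m
are linearly independent and that d_i e_iAe_⊥ is the span of those with m ≥ i
(`map_mulLeft_corner`). The simple socles of the P(j) and simple tops of the I(j) make left
multiplication by d_i injective on e_iA and give e_iAe_⊥ = u_i e_⊥Ae_⊥ (`exists_eq_mul_corner`).

So B∘f_i corresponds to d_i e_iAe_⊥ ≅ e_iAe_⊥, and summing over i gives P(⊥). Two-sidedness,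
locality and the radical are read off from the basis d_m u_m, m ≥ i. -/

namespace OneQH

universe u v w x

/-! ### Modules with a largest proper submodule -/

section Local

variable {R : Type v} [Ring R] {M : Type w} [AddCommGroup M] [Module R M]

theorem isCoatom_iff_of_forall_le_or_eq_top {N : Submodule R M} (hN : N ≠ ⊤)
    (h : ∀ L : Submodule R M, L ≤ N ∨ L = ⊤) (L : Submodule R M) : IsCoatom L ↔ L = N := by
  constructor
  · intro hL
    rcases (h L).resolve_right hL.1 |>.lt_or_eq with h1 | h1
    · exact absurd (hL.2 _ h1) hN
    · exact h1
  · rintro rfl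
    exact ⟨hN, fun L' hL' => (h L').resolve_left (not_le_of_gt hL')⟩

theorem jacobson_eq_of_forall_le_or_eq_top {N : Submodule R M} (hN : N ≠ ⊤)
    (h : ∀ L : Submodule R M, L ≤ N ∨ L = ⊤) : Module.jacobson R M = N := by
  have : {m : Submodule R M | IsCoatom m} = {N} :=
    Set.ext fun L => isCoatom_iff_of_forall_le_or_eq_top hN h L
  rw [Module.jacobson, this, sInf_singleton]

theorem isLocalModule_of_forall_le_or_eq_top {N : Submodule R M} (hN : N ≠ ⊤)
    (h : ∀ L : Submodule R M, L ≤ N ∨ L = ⊤) : IsLocalModule R M := fun L => by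
  rw [jacobson_eq_of_forall_le_or_eq_top hN h]
  exact isCoatom_iff_of_forall_le_or_eq_top hN h L

end Local

/-! ### Dimensions of the components of a module -/

section Edim

variable (K : Type u) [Field K] {A : Type v} [Ring A] [Algebra K A]

/-- The dimension of the subspace `a M` of a module `M`. -/
noncomputable def edim (a : A) (M : Type w) [AddCommGroup M] [Module K M] [Module A M]
    [IsScalarTower K A M] : ℕ :=
  Module.finrank K (LinearMap.range (Algebra.lsmul K K M a))

variable {M : Type w} [AddCommGroup M] [Module K M] [Module A M] [IsScalarTower K A M]
  {M' : Type x} [AddCommGroup M'] [Module K M'] [Module A M'] [IsScalarTower K A M']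

instance finiteDimensional_submodule [FiniteDimensional K M] (N : Submodule A M) :
    FiniteDimensional K N :=
  Module.Finite.of_injective (N.subtype.restrictScalars K) Subtype.val_injective

theorem edim_congr (a : A) (f : M ≃ₗ[A] M') : edim K a M = edim K a M' := by
  have h : (LinearMap.range (Algebra.lsmul K K M a)).map (f.restrictScalars K : M →ₗ[K] M') =
      LinearMap.range (Algebra.lsmul K K M' a) := by
    ext y
    constructor
    · rintro ⟨_, ⟨z, rfl⟩, rfl⟩
      exact ⟨f z, by simp⟩
    · rintro ⟨z, rfl⟩
      exact ⟨a • f.symm z, ⟨f.symm z, rfl⟩, by simp⟩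
  unfold edim
  rw [← h]
  exact (LinearEquiv.finrank_map_eq (f.restrictScalars K) _).symm

theorem edim_eq_zero_iff [FiniteDimensional K M] (a : A) :
    edim K a M = 0 ↔ ∀ m : M, a • m = 0 := by
  rw [edim, Submodule.finrank_eq_zero, LinearMap.range_eq_bot]
  exact LinearMap.ext_iff

/-- Multiplication by an idempotent is exact: if a m lies in N, then a m = a (a m) lies in a N, so a
N is the kernel of a M → a (M/N). -/
theorem edim_eq_add [FiniteDimensional K M] {a : A} (ha : a * a = a) (N : Submodule A M) :
    edim K a M = edim K a N + edim K a (M ⧸ N) := by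
  set E := LinearMap.range (Algebra.lsmul K K M a) with hE
  set f : E →ₗ[K] M ⧸ N := (N.mkQ.restrictScalars K).domRestrict E with hf
  have h1 : LinearMap.range f = LinearMap.range (Algebra.lsmul K K (M ⧸ N) a) := by
    ext y
    constructor
    · rintro ⟨⟨_, z, rfl⟩, rfl⟩
      exact ⟨N.mkQ z, by simp [f]⟩
    · rintro ⟨z, rfl⟩
      obtain ⟨z, rfl⟩ := N.mkQ_surjective z
      exact ⟨⟨_, z, rfl⟩, by simp [f]⟩
  have h2 : (LinearMap.ker f).map E.subtype =
      (LinearMap.range (Algebra.lsmul K K N a)).map (N.subtype.restrictScalars K) := by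
    ext y
    constructor
    · rintro ⟨⟨_, z, rfl⟩, hz, rfl⟩
      have hz' : a • z ∈ N := (Submodule.Quotient.mk_eq_zero N).1 hz
      exact ⟨a • ⟨a • z, hz'⟩, ⟨⟨a • z, hz'⟩, rfl⟩, by simp [← mul_smul, ha]⟩
    · rintro ⟨_, ⟨z, rfl⟩, rfl⟩
      refine ⟨⟨_, (z : M), rfl⟩, ?_, by simp⟩
      exact (Submodule.Quotient.mk_eq_zero N).2 (N.smul_mem a z.2)
  have h3 := LinearMap.finrank_range_add_finrank_ker f
  rw [h1, (Submodule.equivMapOfInjective E.subtype Subtype.val_injective _).finrank_eq, h2,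
    ← (Submodule.equivMapOfInjective (N.subtype.restrictScalars K)
      Subtype.val_injective _).finrank_eq] at h3
  unfold edim
  rw [← hE]
  omega

variable {Λ : Type x} [Fintype Λ]

/-- Ties filtration multiplicities to dimensions. This plays the role of a Jordan–Hölder theorem:
numbers taken from different filtrations become comparable. -/
theorem edim_of_hasFiltration [FiniteDimensional K M] {X : Λ → Type w}
    [∀ k, AddCommGroup (X k)] [∀ k, Module K (X k)]
    [∀ k, Module A (X k)] [∀ k, IsScalarTower K A (X k)] {d : Λ → ℕ}
    (h : HasFiltration (R := A) X M d) {a : A} (ha : a * a = a) :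
    edim K a M = ∑ i, d i * edim K a (X i) := by
  classical
  obtain ⟨r, N, σ, h0, hl, hle, hq, hd⟩ := h
  have key : ∀ t : Fin r, edim K a (N t.succ) =
      edim K a (N t.castSucc) + edim K a (X (σ t)) := fun t => by
    rw [edim_eq_add K ha ((N t.castSucc).submoduleOf (N t.succ)), edim_congr K a (hq t).some]
    congr 1
    exact edim_congr K a (Submodule.submoduleOfEquivOfLe (hle t))
  have key2 : ∀ t : Fin (r + 1), edim K a (N t) =
      ∑ s : Fin r, if s.castSucc < t then edim K a (X (σ s)) else 0 := by
    intro t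
    induction t using Fin.induction with
    | zero =>
      simp only [Fin.not_lt_zero, if_false, Finset.sum_const_zero]
      rw [edim_eq_zero_iff]
      rintro ⟨m, hm⟩
      rw [h0, Submodule.mem_bot] at hm
      subst hm
      exact smul_zero a
    | succ t ih =>
      rw [key, ih, ← Finset.sum_filter, ← Finset.sum_filter, add_comm]
      have : (Finset.univ.filter fun s : Fin r => s.castSucc < t.succ) =
          insert t (Finset.univ.filter fun s : Fin r => s.castSucc < t.castSucc) := by
        ext s
        simp only [Finset.mem_filter, Finset.mem_univ, true_and, Finset.mem_insert,
          Fin.castSucc_lt_succ_iff, Fin.castSucc_lt_castSucc_iff]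
        exact le_iff_eq_or_lt
      rw [this, Finset.sum_insert (by simp)]
  have h1 := key2 (Fin.last r)
  simp only [Fin.castSucc_lt_last, if_true] at h1
  rw [hl, edim_congr K a Submodule.topEquiv] at h1
  rw [h1, ← Finset.sum_fiberwise (s := Finset.univ) (g := σ)]
  refine Finset.sum_congr rfl fun i _ => ?_
  rw [hd, Nat.card_eq_fintype_card, Fintype.card_subtype, Finset.sum_congr rfl (g := fun _ =>
    edim K a (X i)) fun s hs => by rw [(Finset.mem_filter.1 hs).2], Finset.sum_const, smul_eq_mul]

end Edim

/-! ### Split basic algebras -/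

section SplitBasic

/-- `A` is the sum of the span of the orthogonal idempotents `e i` and of the ideal `r`, whose
elements are nilpotent. -/
structure IsSplitBasic {K : Type u} [Field K] {A : Type v} [Ring A] [Algebra K A] {Λ : Type x}
    [Fintype Λ] (e : Λ → A) (r : Submodule K A) : Prop where
  idem : CompleteOrthogonalIdempotents e
  mul_left : ∀ a y : A, y ∈ r → a * y ∈ r
  mul_right : ∀ a y : A, y ∈ r → y * a ∈ r
  nilpotent : ∀ y ∈ r, IsNilpotent y
  diag : ∀ (i : Λ) (a : A), ∃ c : K, e i * a * e i - c • e i ∈ r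
  off_diag : ∀ (i j : Λ) (a : A), i ≠ j → e i * a * e j ∈ r
  notMem : ∀ i : Λ, e i ∉ r

variable {K : Type u} [Field K] {A : Type v} [Ring A] [Algebra K A] {Λ : Type x} [Fintype Λ]
  {e : Λ → A} {r : Submodule K A}

theorem mul_e_of_mem_proj (he : CompleteOrthogonalIdempotents e) {i : Λ} {a : A}
    (ha : a ∈ proj e i) : a * e i = a := by
  obtain ⟨b, rfl⟩ := Submodule.mem_span_singleton.1 ha
  rw [smul_eq_mul, mul_assoc, he.idem i]

omit [Fintype Λ] in
theorem mem_proj_of_mul_e {i : Λ} {a : A} (ha : a * e i = a) : a ∈ proj e i :=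
  Submodule.mem_span_singleton.2 ⟨a, ha⟩

/-- The generator of `P(i)`. -/
def projGen (e : Λ → A) (i : Λ) : proj e i := ⟨e i, Submodule.mem_span_singleton_self _⟩

theorem smul_projGen (he : CompleteOrthogonalIdempotents e) {i : Λ} (y : proj e i) :
    (y : A) • projGen e i = y :=
  Subtype.ext (mul_e_of_mem_proj he y.2)

/-- The map `P(i) → M` that sends `e i` to `e i • m`. -/
def projLift (e : Λ → A) (i : Λ) {M : Type w} [AddCommGroup M] [Module A M] (m : M) :
    proj e i →ₗ[A] M :=
  (LinearMap.toSpanSingleton A M m).comp (proj e i).subtype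

namespace IsSplitBasic

/-- Left-right symmetry allows every one-sided result to be reused over the opposite algebra, where
the duals of the injective and costandard modules live. -/
theorem op (h : IsSplitBasic e r) :
    IsSplitBasic (opIdem e) (r.map (MulOpposite.opLinearEquiv K : A ≃ₗ[K] Aᵐᵒᵖ).toLinearMap) := by
  have hm : ∀ y : Aᵐᵒᵖ,
      y ∈ r.map (MulOpposite.opLinearEquiv K : A ≃ₗ[K] Aᵐᵒᵖ).toLinearMap ↔ y.unop ∈ r := by
    intro y
    constructor
    · rintro ⟨z, hz, rfl⟩
      exact hz
    · intro hy
      exact ⟨_, hy, rfl⟩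
  refine ⟨⟨⟨fun i => ?_, fun i j hij => ?_⟩, ?_⟩, fun a y hy => ?_, fun a y hy => ?_,
    fun y hy => ?_, fun i a => ?_, fun i j a hij => ?_, fun i => ?_⟩
  · exact congrArg MulOpposite.op (h.idem.idem i)
  · exact congrArg MulOpposite.op (h.idem.ortho hij.symm)
  · apply MulOpposite.unop_injective
    simp [h.idem.complete]
  · rw [hm] at hy ⊢
    exact h.mul_right _ _ hy
  · rw [hm] at hy ⊢
    exact h.mul_left _ _ hy
  · rw [hm] at hy
    obtain ⟨n, hn⟩ := h.nilpotent _ hy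
    exact ⟨n, MulOpposite.unop_injective (by simpa using hn)⟩
  · obtain ⟨c, hc⟩ := h.diag i a.unop
    refine ⟨c, ?_⟩
    rw [hm]
    simpa [mul_assoc] using hc
  · rw [hm]
    simpa [mul_assoc] using h.off_diag j i a.unop hij.symm
  · rw [hm]
    exact h.notMem i

theorem sum_e_smul (h : IsSplitBasic e r) {M : Type w} [AddCommGroup M] [Module A M] (m : M) :
    ∑ i, e i • m = m := by
  rw [← Finset.sum_smul, h.idem.complete, one_smul]

theorem exists_smul_ne_zero (h : IsSplitBasic e r) {M : Type w} [AddCommGroup M] [Module A M]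
    {m : M} (hm : m ≠ 0) : ∃ i, e i • m ≠ 0 := by
  by_contra! hc
  exact hm (by rw [← h.sum_e_smul m]; simp [hc])

theorem isUnit_smul_one_add (h : IsSplitBasic e r) {c : K} (hc : c ≠ 0) {y : A} (hy : y ∈ r) :
    IsUnit (c • (1 : A) + y) := by
  have h1 : IsUnit (1 + c⁻¹ • y) := (h.nilpotent _ (r.smul_mem _ hy)).isUnit_one_add
  have h2 : c • (1 : A) + y = algebraMap K A c * (1 + c⁻¹ • y) := by
    rw [← Algebra.smul_def, smul_add, smul_smul, mul_inv_cancel₀ hc, one_smul]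
  rw [h2]
  exact ((IsUnit.mk0 c hc).map (algebraMap K A)).mul h1

/-- The radical of `P(i)`. -/
def radProj (h : IsSplitBasic e r) (i : Λ) : Submodule A (proj e i) where
  carrier := {y | (y : A) ∈ r}
  add_mem' := fun ha hb => r.add_mem ha hb
  zero_mem' := r.zero_mem
  smul_mem' := fun a y hy => h.mul_left a y hy

theorem mem_radProj (h : IsSplitBasic e r) {i : Λ} {y : proj e i} :
    y ∈ h.radProj i ↔ (y : A) ∈ r := Iff.rfl

theorem radProj_ne_top (h : IsSplitBasic e r) (i : Λ) : h.radProj i ≠ ⊤ := fun ht =>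
  h.notMem i (h.mem_radProj.1 (ht ▸ Submodule.mem_top : projGen e i ∈ h.radProj i))

theorem sub_smul_mem (h : IsSplitBasic e r) {i : Λ} {y : A} (hy : y ∈ proj e i) :
    ∃ c : K, y - c • e i ∈ r := by
  classical
  have hyi := mul_e_of_mem_proj h.idem hy
  obtain ⟨c, hc⟩ := h.diag i y
  refine ⟨c, ?_⟩
  have h1 : y - c • e i = (e i * y * e i - c • e i) + ∑ k ∈ Finset.univ.erase i, e k * y * e i := by
    have : y = ∑ k, e k * y * e i := by
      rw [← Finset.sum_mul, ← Finset.sum_mul, h.idem.complete, one_mul, hyi]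
    rw [← Finset.add_sum_erase _ _ (Finset.mem_univ i)] at this
    nth_rw 1 [this]
    abel
  rw [h1]
  exact r.add_mem hc (r.sum_mem fun k hk => h.off_diag k i y (Finset.ne_of_mem_erase hk))

/-- An element y of P(i) outside r equals c e_i plus an element of r with c ≠ 0. Then c + (y - c
e_i) is a unit that sends e_i to y, so y generates P(i). -/
theorem le_radProj_or_eq_top (h : IsSplitBasic e r) (i : Λ) (L : Submodule A (proj e i)) :
    L ≤ h.radProj i ∨ L = ⊤ := by
  by_contra! hL
  obtain ⟨y, hyL, hy⟩ := Set.not_subset.1 hL.1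
  have hy : (y : A) ∉ r := hy
  obtain ⟨c, hc⟩ := h.sub_smul_mem y.2
  have hc0 : c ≠ 0 := by
    rintro rfl
    exact hy (by simpa using hc)
  obtain ⟨t, ht⟩ := (h.isUnit_smul_one_add hc0 hc).exists_left_inv
  refine hL.2 ((Submodule.eq_top_iff').2 fun z => ?_)
  have h2 : t • y = projGen e i := by
    apply Subtype.ext
    have := congrArg (· * e i) ht
    simp only [mul_assoc, add_mul, sub_mul, smul_mul_assoc, one_mul, (h.idem.idem i).eq,
      mul_e_of_mem_proj h.idem y.2, add_sub_cancel] at this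
    exact this
  rw [← smul_projGen h.idem z, ← h2]
  exact L.smul_mem _ (L.smul_mem _ hyL)

theorem jacobson_proj (h : IsSplitBasic e r) (i : Λ) :
    Module.jacobson A (proj e i) = h.radProj i :=
  jacobson_eq_of_forall_le_or_eq_top (h.radProj_ne_top i) (h.le_radProj_or_eq_top i)

theorem simple_mk_eq_zero (h : IsSplitBasic e r) {i : Λ} {y : proj e i} :
    (Submodule.Quotient.mk y : simple e i) = 0 ↔ (y : A) ∈ r := by
  rw [Submodule.Quotient.mk_eq_zero, h.jacobson_proj, mem_radProj]

theorem edim_simple_self [FiniteDimensional K A] (h : IsSplitBasic e r) (i : Λ) :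
    edim K (e i) (simple e i) = 1 := by
  let g : simple e i := Submodule.Quotient.mk (projGen e i)
  have hg : e i • g = g := by
    rw [← Submodule.Quotient.mk_smul]
    exact congrArg _ (smul_projGen h.idem (projGen e i))
  refine finrank_eq_one_iff'.2 ⟨⟨g, g, hg⟩, ?_, ?_⟩
  · intro h0
    exact h.notMem i (h.simple_mk_eq_zero.1 (congrArg Subtype.val h0))
  · rintro ⟨_, z, rfl⟩
    obtain ⟨z, rfl⟩ := Submodule.Quotient.mk_surjective _ z
    obtain ⟨c, hc⟩ := h.sub_smul_mem (e i • z).2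
    refine ⟨c, Subtype.ext ?_⟩
    change c • g = e i • Submodule.Quotient.mk z
    rw [eq_comm, ← sub_eq_zero]
    exact h.simple_mk_eq_zero.2 hc

theorem edim_simple_of_ne [FiniteDimensional K A] (h : IsSplitBasic e r) {i k : Λ}
    (hik : k ≠ i) : edim K (e k) (simple e i) = 0 := by
  rw [edim_eq_zero_iff]
  intro z
  obtain ⟨z, rfl⟩ := Submodule.Quotient.mk_surjective _ z
  refine h.simple_mk_eq_zero.2 ?_
  have := h.off_diag k i z hik
  rwa [mul_assoc, mul_e_of_mem_proj h.idem z.2] at this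

/-- The space e_k S(i) has dimension 1 for i = k and 0 otherwise, so multiplicities of simple
modules are dimensions of components. -/
theorem edim_of_hasMult [FiniteDimensional K A] (h : IsSplitBasic e r) {M : Type v}
    [AddCommGroup M] [Module K M] [Module A M] [IsScalarTower K A M] [FiniteDimensional K M]
    {k : Λ} {m : ℕ} (hm : HasMult A (simple e) M k m) : edim K (e k) M = m := by
  classical
  obtain ⟨d, hd, rfl⟩ := hm
  rw [edim_of_hasFiltration K hd (h.idem.idem k), Finset.sum_eq_single k,
    h.edim_simple_self, mul_one]
  · intro i _ hi
    rw [h.edim_simple_of_ne hi.symm, mul_zero]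
  · simp

theorem exists_equiv_simple (h : IsSplitBasic e r) (M : Type w) [AddCommGroup M] [Module A M]
    [IsSimpleModule A M] : ∃ i, Nonempty (M ≃ₗ[A] simple e i) := by
  have := IsSimpleModule.nontrivial A M
  obtain ⟨m, hm⟩ := exists_ne (0 : M)
  obtain ⟨i, hi⟩ := h.exists_smul_ne_zero hm
  have hs : Function.Surjective (projLift e i m) := by
    rw [← LinearMap.range_eq_top]
    refine (eq_bot_or_eq_top _).resolve_left fun hb => hi ?_
    have : e i • m ∈ LinearMap.range (projLift e i m) := ⟨projGen e i, rfl⟩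
    rwa [hb, Submodule.mem_bot] at this
  have e1 := (projLift e i m).quotKerEquivOfSurjective hs
  have hco : IsCoatom (LinearMap.ker (projLift e i m)) := by
    rw [← isSimpleModule_iff_isCoatom]
    exact IsSimpleModule.congr e1
  refine ⟨i, ⟨e1.symm.trans (Submodule.quotEquivOfEq _ _ ?_)⟩⟩
  rw [h.jacobson_proj]
  exact (isCoatom_iff_of_forall_le_or_eq_top (h.radProj_ne_top i)
    (h.le_radProj_or_eq_top i) _).1 hco

theorem exists_hasFiltration_simple [FiniteDimensional K A] (h : IsSplitBasic e r) (M : Type w)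
    [AddCommGroup M] [Module K M] [Module A M] [IsScalarTower K A M] [FiniteDimensional K M] :
    ∃ d, HasFiltration (R := A) (simple e) M d := by
  have : IsNoetherian A M := isNoetherian_of_tower K inferInstance
  have : IsArtinian A M := isArtinian_of_tower K inferInstance
  obtain ⟨s, h0, h1⟩ := exists_compositionSeries_of_isNoetherian_isArtinian A M
  have hs : ∀ t : Fin s.length, ∃ i,
      Nonempty ((↥(s t.succ) ⧸ (s t.castSucc).submoduleOf (s t.succ)) ≃ₗ[A] simple e i) := by
    intro t
    have : IsSimpleModule A (↥(s t.succ) ⧸ (s t.castSucc).submoduleOf (s t.succ)) :=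
      (covBy_iff_quot_is_simple (s.step t).le).1 (s.step t)
    exact h.exists_equiv_simple _
  choose σ hσ using hs
  exact ⟨_, s.length, s.toFun, σ, h0, h1, fun t => (s.step t).le, hσ, fun k => rfl⟩

/-- `HasMult` asserts that a filtration exists, so the vanishing of e_k M is combined with a
composition series. -/
theorem hasMult_zero [FiniteDimensional K A] (h : IsSplitBasic e r) {M : Type v}
    [AddCommGroup M] [Module K M] [Module A M] [IsScalarTower K A M] [FiniteDimensional K M]
    {k : Λ} (hm : ∀ m : M, e k • m = 0) : HasMult A (simple e) M k 0 := by
  obtain ⟨d, hd⟩ := h.exists_hasFiltration_simple (K := K) M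
  have h1 := h.edim_of_hasMult (k := k) ⟨d, hd, rfl⟩
  rw [(edim_eq_zero_iff K (e k)).2 hm] at h1
  exact ⟨d, hd, h1.symm⟩

end IsSplitBasic
end SplitBasic

/-! ### Corners and standard modules -/

section Corner

variable {K : Type u} [Field K] {A : Type v} [Ring A] [Algebra K A] {Λ : Type x} [Fintype Λ]
  {e : Λ → A} {r : Submodule K A}

/-- The subspace `e k * A * e j` of `A`. -/
def corner (K : Type u) [Field K] {A : Type v} [Ring A] [Algebra K A] {Λ : Type x} (e : Λ → A)
    (k j : Λ) : Submodule K A where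
  carrier := {a | e k * a = a ∧ a * e j = a}
  add_mem' := fun ha hb =>
    ⟨by rw [mul_add, ha.1, hb.1], by rw [add_mul, ha.2, hb.2]⟩
  zero_mem' := ⟨mul_zero _, zero_mul _⟩
  smul_mem' := fun c a ha =>
    ⟨by rw [mul_smul_comm, ha.1], by rw [smul_mul_assoc, ha.2]⟩

theorem mul_mul_mem_corner (he : CompleteOrthogonalIdempotents e) (k j : Λ) (a : A) :
    e k * a * e j ∈ corner K e k j :=
  ⟨by rw [← mul_assoc, ← mul_assoc, he.idem k], by rw [mul_assoc, he.idem j]⟩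

omit [Fintype Λ] in
theorem mul_mem_corner {k l j : Λ} {a b : A} (ha : a ∈ corner K e k l)
    (hb : b ∈ corner K e l j) : a * b ∈ corner K e k j :=
  ⟨by rw [← mul_assoc, ha.1], by rw [mul_assoc, hb.2]⟩

omit [Fintype Λ] in
theorem corner_mul_le (k l j : Λ) : corner K e k l * corner K e l j ≤ corner K e k j :=
  Submodule.mul_le.2 fun _ ha _ hb => mul_mem_corner ha hb

omit [Fintype Λ] in
theorem mem_proj_of_mem_corner {k j : Λ} {a : A} (ha : a ∈ corner K e k j) : a ∈ proj e j :=
  mem_proj_of_mul_e ha.2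

theorem e_mem_corner (he : CompleteOrthogonalIdempotents e) (k : Λ) : e k ∈ corner K e k k :=
  ⟨he.idem k, he.idem k⟩

theorem e_mul_mem_corner (he : CompleteOrthogonalIdempotents e) (k : Λ) {j : Λ} {a : A}
    (ha : a ∈ proj e j) : e k * a ∈ corner K e k j :=
  ⟨by rw [← mul_assoc, he.idem k], by rw [mul_assoc, mul_e_of_mem_proj he ha]⟩

theorem finrank_corner [FiniteDimensional K A] (he : CompleteOrthogonalIdempotents e) (k j : Λ) :
    Module.finrank K (corner K e k j) = edim K (e k) (proj e j) := by
  have : corner K e k j = (LinearMap.range (Algebra.lsmul K K (proj e j) (e k))).map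
      ((proj e j).subtype.restrictScalars K) := by
    ext a
    constructor
    · intro ha
      exact ⟨_, ⟨⟨a, mem_proj_of_mem_corner ha⟩, rfl⟩, ha.1⟩
    · rintro ⟨_, ⟨a, rfl⟩, rfl⟩
      exact e_mul_mem_corner he k a.2
  rw [this, edim]
  exact (Submodule.equivMapOfInjective ((proj e j).subtype.restrictScalars K)
    Subtype.val_injective _).finrank_eq.symm

variable [PartialOrder Λ] [FiniteDimensional K A]

namespace IsSplitBasic

/-- A quotient P(i)/U avoids S(k) exactly when e_k kills it, that is, when U contains e_k P(i). -/
theorem stdKer_eq (h : IsSplitBasic e r) (i : Λ) :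
    stdKer e i = Submodule.span A {y : proj e i | ∃ k, ¬ k ≤ i ∧ e k * (y : A) = y} := by
  apply le_antisymm
  · refine sInf_le fun k hk => h.hasMult_zero (K := K) fun m => ?_
    obtain ⟨z, rfl⟩ := Submodule.Quotient.mk_surjective _ m
    refine (Submodule.Quotient.mk_eq_zero _).2 (Submodule.subset_span ⟨k, hk, ?_⟩)
    change e k * (e k * (z : A)) = e k * (z : A)
    rw [← mul_assoc, h.idem.idem k]
  · refine le_sInf fun U hU => Submodule.span_le.2 ?_
    rintro y ⟨k, hk, hy⟩
    have h1 := (edim_eq_zero_iff K (e k)).1 (h.edim_of_hasMult (hU k hk))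
      (Submodule.Quotient.mk y)
    have h2 := (Submodule.Quotient.mk_eq_zero U).1 h1
    have h3 : e k • y = y := Subtype.ext hy
    exact h3 ▸ h2

theorem mem_stdKer (h : IsSplitBasic e r) {i k : Λ} (hk : ¬ k ≤ i) {y : proj e i}
    (hy : e k * (y : A) = y) : y ∈ stdKer e i := by
  rw [h.stdKer_eq]
  exact Submodule.subset_span ⟨k, hk, hy⟩

theorem smul_std_eq_zero (h : IsSplitBasic e r) {i k : Λ} (hk : ¬ k ≤ i) (m : std e i) :
    e k • m = 0 := by
  obtain ⟨z, rfl⟩ := Submodule.Quotient.mk_surjective _ m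
  refine (Submodule.Quotient.mk_eq_zero _).2 (h.mem_stdKer hk ?_)
  change e k * (e k * (z : A)) = e k * (z : A)
  rw [← mul_assoc, h.idem.idem k]

theorem stdKer_top [OrderTop Λ] (h : IsSplitBasic e r) : stdKer e (⊤ : Λ) = ⊥ := by
  rw [h.stdKer_eq, Submodule.span_eq_bot]
  rintro y ⟨k, hk, -⟩
  exact absurd le_top hk

theorem coe_mem_of_mem_stdKer (h : IsSplitBasic e r) {i : Λ} {y : proj e i}
    (hy : y ∈ stdKer e i) :
    (y : A) ∈ ⨆ (l : Λ) (_ : ¬ l ≤ i), (⊤ : Submodule K A) * corner K e l i := by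
  rw [h.stdKer_eq] at hy
  induction hy using Submodule.span_induction with
  | mem y hy =>
    obtain ⟨k, hk, hy⟩ := hy
    refine Submodule.mem_iSup_of_mem k (Submodule.mem_iSup_of_mem hk ?_)
    rw [← one_mul (y : A)]
    exact Submodule.mul_mem_mul Submodule.mem_top ⟨hy, mul_e_of_mem_proj h.idem y.2⟩
  | zero => exact Submodule.zero_mem _
  | add _ _ _ _ h1 h2 => exact Submodule.add_mem _ h1 h2
  | smul a y _ hy =>
    have h1 := Submodule.mul_mem_mul (Submodule.mem_top : a ∈ (⊤ : Submodule K A)) hy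
    simp only [Submodule.mul_iSup, ← mul_assoc] at h1
    have h2 : (⨆ (l : Λ) (_ : ¬ l ≤ i), (⊤ : Submodule K A) * ⊤ * corner K e l i) ≤
        ⨆ (l : Λ) (_ : ¬ l ≤ i), (⊤ : Submodule K A) * corner K e l i :=
      iSup₂_mono fun l _ => mul_le_mul_left le_top _
    exact h2 h1

/-- Translates membership in the kernel of P(i) → Δ(i) into factorization, inside A, through
vertices l ≰ i. -/
theorem mem_of_mem_stdKer (h : IsSplitBasic e r) {i k : Λ} {y : proj e i}
    (hy : y ∈ stdKer e i) (hk : e k * (y : A) = y) :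
    (y : A) ∈ ⨆ (l : Λ) (_ : ¬ l ≤ i), corner K e k l * corner K e l i := by
  have h1 : (⨆ (l : Λ) (_ : ¬ l ≤ i), (⊤ : Submodule K A) * corner K e l i) ≤
      (⨆ (l : Λ) (_ : ¬ l ≤ i), corner K e k l * corner K e l i).comap
        (LinearMap.mulLeft K (e k)) := by
    refine iSup₂_le fun l hl => Submodule.mul_le.2 fun a _ b hb => ?_
    refine Submodule.mem_iSup_of_mem l (Submodule.mem_iSup_of_mem hl ?_)
    have : LinearMap.mulLeft K (e k) (a * b) = (e k * a * e l) * b := by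
      rw [LinearMap.mulLeft_apply, mul_assoc _ (e l), hb.1, mul_assoc]
    rw [this]
    exact Submodule.mul_mem_mul (mul_mul_mem_corner h.idem _ _ _) hb
  have h2 := h1 (h.coe_mem_of_mem_stdKer hy)
  rwa [Submodule.mem_comap, LinearMap.mulLeft_apply, hk] at h2

/-- An embedding of `Δ(i)` into `Δ(⊤) = P(⊤)` is right multiplication by an element. -/
theorem exists_mul_eq_zero_iff_mem_stdKer [OrderTop Λ] (h : IsSplitBasic e r) {i : Λ}
    {g : std e i →ₗ[A] std e ⊤} (hg : Function.Injective g) :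
    ∃ v ∈ corner K e i ⊤, ∀ y : proj e i, (y : A) * v = 0 ↔ y ∈ stdKer e i := by
  obtain ⟨z, hz⟩ := Submodule.Quotient.mk_surjective _ (g (Submodule.Quotient.mk (projGen e i)))
  have hgy : ∀ y : proj e i, g (Submodule.Quotient.mk y) = Submodule.Quotient.mk ((y : A) • z) := by
    intro y
    rw [Submodule.Quotient.mk_smul, hz, ← map_smul, ← Submodule.Quotient.mk_smul,
      smul_projGen h.idem]
  refine ⟨e i * z, e_mul_mem_corner h.idem i z.2, fun y => ?_⟩
  have h1 : (y : A) * (e i * z) = ((y : A) • z : proj e (⊤ : Λ)) := by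
    rw [← mul_assoc, mul_e_of_mem_proj h.idem y.2]
    rfl
  rw [h1, ZeroMemClass.coe_eq_zero, ← Submodule.mem_bot A, ← h.stdKer_top,
    ← Submodule.Quotient.mk_eq_zero, ← hgy, ← Submodule.Quotient.mk_eq_zero (stdKer e i)]
  exact map_eq_zero_iff g hg

open Classical in
theorem edim_std (h : IsSplitBasic e r)
    (hs : ∀ i j : Λ, j ≤ i → HasMult A (simple e) (std e i) j 1) (k i : Λ) :
    edim K (e k) (std e i) = if k ≤ i then 1 else 0 := by
  split_ifs with hk
  · exact h.edim_of_hasMult (hs i k hk)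
  · exact (edim_eq_zero_iff K (e k)).2 (h.smul_std_eq_zero hk)

end IsSplitBasic

end Corner

/-! ### Standard filtrations and the dimensions of corners -/

open Classical in
-- The incidence matrix of a finite poset is unitriangular; the values are recovered from the
-- maximal elements downwards.
theorem eq_of_forall_sum_le_eq {Λ : Type x} [Fintype Λ] [PartialOrder Λ] {d d' : Λ → ℕ}
    (h : ∀ k, ∑ i, d i * (if k ≤ i then 1 else 0) = ∑ i, d' i * (if k ≤ i then 1 else 0)) :
    d = d' := by
  have key : ∀ (c : Λ → ℕ) (k : Λ), ∑ i, c i * (if k ≤ i then 1 else 0) =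
      c k + ∑ i with k < i, c i := by
    intro c k
    have : (Finset.univ.filter fun i => k ≤ i) = insert k (Finset.univ.filter fun i => k < i) := by
      ext i
      simp [le_iff_eq_or_lt, eq_comm]
    simp only [mul_ite, mul_one, mul_zero]
    rw [← Finset.sum_filter, this, Finset.sum_insert (by simp)]
  funext k
  induction k using WellFoundedGT.induction with
  | ind k ih =>
    have h1 := h k
    rw [key, key, Finset.sum_congr rfl fun i hi => ih i (Finset.mem_filter.1 hi).2] at h1
    exact Nat.add_right_cancel h1

section OneQuasiHereditary

variable {K : Type u} [Field K] {A : Type v} [Ring A] [Algebra K A] {Λ : Type x} [Fintype Λ]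
  {e : Λ → A} {r : Submodule K A} [PartialOrder Λ] [BoundedOrder Λ] [FiniteDimensional K A]

open Classical in
-- Each axiom on (P(j) : Δ(i)) may be witnessed by a different filtration. The dimensions of the e_k
-- P(j) determine all multiplicities, so a single filtration realizes them simultaneously.
theorem exists_hasFiltration_std (h : IsSplitBasic e r) (hA : IsOneQuasiHereditary K e) (j : Λ) :
    HasFiltration (R := A) (std e) (proj e j) fun i => if j ≤ i then 1 else 0 := by
  obtain ⟨d, hd, -⟩ := hA.proj_self j
  have hd' : ∀ d', HasFiltration (R := A) (std e) (proj e j) d' → d = d' := by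
    intro d' hd'
    refine eq_of_forall_sum_le_eq fun k => ?_
    have h1 := edim_of_hasFiltration K hd (h.idem.idem k)
    rw [edim_of_hasFiltration K hd' (h.idem.idem k)] at h1
    simpa only [h.edim_std hA.std_mult] using h1.symm
  convert hd using 2 with i
  split_ifs with hi
  · obtain ⟨d', h1, h2⟩ := hA.proj_mult i j hi
    rw [hd' d' h1, h2]
  · obtain ⟨d', h1, h2⟩ := hA.proj_not_ge j i hi
    rw [hd' d' h1, h2]

open Classical in
-- The dimension of e_k P(j) is the sum over i of (P(j) : Δ(i)) [Δ(i) : S(k)], and both factors are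
-- 0 or 1.
theorem finrank_corner_eq (h : IsSplitBasic e r) (hA : IsOneQuasiHereditary K e) (k j : Λ) :
    Module.finrank K (corner K e k j) = Finset.card {i : Λ | k ≤ i ∧ j ≤ i} := by
  rw [finrank_corner h.idem, edim_of_hasFiltration K (exists_hasFiltration_std h hA j)
    (h.idem.idem k), Finset.card_filter]
  refine Finset.sum_congr rfl fun i _ => ?_
  rw [h.edim_std hA.std_mult]
  by_cases h1 : k ≤ i <;> by_cases h2 : j ≤ i <;> simp [h1, h2]

omit [BoundedOrder Λ] [FiniteDimensional K A] in
/-- The generators of the factors in a filtration by standard modules. -/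
theorem exists_generator (h : IsSplitBasic e r) {M : Type v} [AddCommGroup M] [Module A M]
    {N N' : Submodule A M} {i : Λ} (φ : (↥N' ⧸ N.submoduleOf N') ≃ₗ[A] std e i) :
    ∃ z ∈ N', e i • z = z ∧ (∀ m ∈ N', ∃ y : proj e i, m - (y : A) • z ∈ N) ∧
      ∀ y : proj e i, (y : A) • z ∈ N → y ∈ stdKer e i := by
  obtain ⟨z, hz⟩ := Submodule.Quotient.mk_surjective _
    (φ.symm (Submodule.Quotient.mk (projGen e i)))
  have hy : ∀ y : proj e i, φ (Submodule.Quotient.mk ((y : A) • e i • z)) =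
      Submodule.Quotient.mk y := by
    intro y
    rw [smul_smul, mul_e_of_mem_proj h.idem y.2, Submodule.Quotient.mk_smul, hz, map_smul,
      LinearEquiv.apply_symm_apply, ← Submodule.Quotient.mk_smul, smul_projGen h.idem]
  refine ⟨(e i • z : N'), (e i • z).2, ?_, fun m hm => ?_, fun y hyN => ?_⟩
  · rw [Submodule.coe_smul, smul_smul, h.idem.idem i]
  · obtain ⟨y, hm'⟩ := Submodule.Quotient.mk_surjective _ (φ (Submodule.Quotient.mk ⟨m, hm⟩))
    refine ⟨y, ?_⟩
    rw [← hy y, φ.injective.eq_iff, eq_comm] at hm'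
    exact (Submodule.Quotient.eq (N.submoduleOf N')).1 hm'
  · have h1 : (Submodule.Quotient.mk ((y : A) • e i • z) : ↥N' ⧸ N.submoduleOf N') = 0 :=
      (Submodule.Quotient.mk_eq_zero _).2 hyN
    have h2 := hy y
    rw [h1, map_zero, eq_comm] at h2
    exact (Submodule.Quotient.mk_eq_zero _).1 h2

/-- The Δ(i) occurring in P(k) have k ≤ i, each is generated by its e_i-component, and e_c Δ(i) = 0
unless c ≤ i. Climbing the filtration therefore factors e_cAe_k through common upper bounds. -/
theorem corner_le (h : IsSplitBasic e r) (hA : IsOneQuasiHereditary K e) (c k : Λ) :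
    corner K e c k ≤ ⨆ (i : Λ) (_ : c ≤ i ∧ k ≤ i), corner K e c i * corner K e i k := by
  classical
  obtain ⟨n, N, σ, h0, hl, hle, hq, hd⟩ := exists_hasFiltration_std h hA k
  have hσ : ∀ t, k ≤ σ t := by
    intro t
    by_contra hk
    have h1 := hd (σ t)
    simp only [if_neg hk] at h1
    rw [eq_comm, Nat.card_eq_zero] at h1
    rcases h1 with h1 | h1
    · exact h1.false ⟨t, rfl⟩
    · exact h1.not_finite inferInstance
  have key : ∀ (t : Fin (n + 1)) (y : proj e k), y ∈ N t → e c * (y : A) ∈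
      ⨆ (i : Λ) (_ : c ≤ i ∧ k ≤ i), corner K e c i * corner K e i k := by
    intro t
    induction t using Fin.induction with
    | zero =>
      intro y hy
      rw [h0, Submodule.mem_bot] at hy
      rw [hy, ZeroMemClass.coe_zero, mul_zero]
      exact Submodule.zero_mem _
    | succ t ih =>
      intro y hy
      obtain ⟨z, hz, hez, hgen, -⟩ := exists_generator h (hq t).some
      by_cases hc : c ≤ σ t
      · obtain ⟨x, hx⟩ := hgen y hy
        have h1 : e c * (y : A) = e c * ((y - (x : A) • z : proj e k) : A) +
            (e c * (x : A)) * (z : A) := by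
          change e c * (y : A) = e c * ((y : A) - (x : A) * (z : A)) + (e c * (x : A)) * (z : A)
          rw [mul_sub, mul_assoc, sub_add_cancel]
        rw [h1]
        refine Submodule.add_mem _ (ih _ hx) (Submodule.mem_iSup_of_mem (σ t)
          (Submodule.mem_iSup_of_mem ⟨hc, hσ t⟩ (Submodule.mul_mem_mul ?_ ?_)))
        · exact e_mul_mem_corner h.idem c x.2
        · exact ⟨congrArg Subtype.val hez, mul_e_of_mem_proj h.idem z.2⟩
      · have h1 : e c • (Submodule.Quotient.mk ⟨y, hy⟩ :
            ↥(N t.succ) ⧸ (N t.castSucc).submoduleOf (N t.succ)) = 0 := by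
          apply (hq t).some.injective
          rw [map_smul, h.smul_std_eq_zero hc, map_zero]
        have h2 : e c • y ∈ N t.castSucc :=
          (Submodule.Quotient.mk_eq_zero ((N t.castSucc).submoduleOf (N t.succ))).1 h1
        have h3 := ih _ h2
        change e c * (e c * (y : A)) ∈ _ at h3
        rwa [← mul_assoc, h.idem.idem c] at h3
  intro a ha
  have := key (Fin.last n) ⟨a, mem_proj_of_mem_corner ha⟩ (by rw [hl]; trivial)
  rwa [show e c * a = a from ha.1] at this

/-- Since Δ(⊤) = P(⊤), a lift z of the generator of the factor Δ(⊤) of P(k) has zero annihilator in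
P(⊤). -/
theorem exists_top_generator (h : IsSplitBasic e r) (hA : IsOneQuasiHereditary K e) (k : Λ) :
    ∃ z ∈ corner K e ⊤ k, ∀ y ∈ proj e (⊤ : Λ), y * z = 0 → y = 0 := by
  obtain ⟨d, ⟨n, N, σ, h0, hl, hle, hq, hd⟩, hd1⟩ := hA.proj_mult ⊤ k le_top
  rw [hd] at hd1
  obtain ⟨⟨t, ht⟩⟩ : Nonempty {t // σ t = ⊤} := (Nat.card_pos_iff.1 (hd1 ▸ one_pos)).1
  obtain ⟨z, hz, hez, -, hgen⟩ := exists_generator h (hq t).some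
  rw [ht] at hez hgen
  refine ⟨z, ⟨congrArg Subtype.val hez, mul_e_of_mem_proj h.idem z.2⟩, fun y hy hyz => ?_⟩
  have h1 := hgen ⟨y, hy⟩ (by
    rw [show (y • z : proj e k) = 0 from Subtype.ext hyz]
    exact Submodule.zero_mem _)
  rw [h.stdKer_top, Submodule.mem_bot] at h1
  exact congrArg Subtype.val h1

end OneQuasiHereditary

/-! ### Duality -/

section Duality

variable {K : Type u} [Field K] {A : Type v} [Ring A] [Algebra K A]
  {N : Type w} [AddCommGroup N] [Module K N]

instance : Module K (StdDual K A N) := inferInstanceAs (Module K (N →ₗ[K] K))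

instance [FiniteDimensional K N] : FiniteDimensional K (StdDual K A N) :=
  inferInstanceAs (FiniteDimensional K (N →ₗ[K] K))

variable [Module Aᵐᵒᵖ N] [IsScalarTower K Aᵐᵒᵖ N]

/-- A functional on `N` as an element of the dual module. -/
def StdDual.of (A : Type v) (φ : Module.Dual K N) : StdDual K A N := φ

/-- An element of the dual module as a functional. -/
def StdDual.toDual (φ : StdDual K A N) : Module.Dual K N := φ

instance : IsScalarTower K A (StdDual K A N) := by
  refine IsScalarTower.of_algebraMap_smul fun c φ => LinearMap.ext fun y => ?_
  change φ.toDual (MulOpposite.op (algebraMap K A c) • y) = c • φ.toDual y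
  rw [← map_smul, ← algebraMap_smul Aᵐᵒᵖ c y]
  rfl

variable {N' : Type x} [AddCommGroup N'] [Module K N'] [Module Aᵐᵒᵖ N'] [IsScalarTower K Aᵐᵒᵖ N']

theorem eq_of_forall_dual {a b : N} (h : ∀ φ : Module.Dual K N, φ a = φ b) : a = b := by
  rw [← sub_eq_zero, ← Module.forall_dual_apply_eq_zero_iff K]
  intro φ
  rw [map_sub, h, sub_self]

/-- A surjection between dual modules is the dual of an injection. -/
theorem exists_injective_of_surjective_stdDual [FiniteDimensional K N]
    (g : StdDual K A N →ₗ[A] StdDual K A N') (hg : Function.Surjective g) :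
    ∃ f : N' →ₗ[Aᵐᵒᵖ] N, Function.Injective f := by
  -- The transpose of g, read through the identification of N with its bidual.
  let f0 : N' → N := fun y => (Module.evalEquiv K N).symm
    { toFun := fun φ => (g (StdDual.of A φ)).toDual y
      map_add' := fun φ ψ => by
        rw [show StdDual.of A (φ + ψ) = StdDual.of A φ + StdDual.of A ψ from rfl, map_add]
        rfl
      map_smul' := fun c φ => by
        rw [show StdDual.of A (c • φ) = c • StdDual.of A φ from rfl, LinearMap.map_smul_of_tower]
        rfl }
  have hf : ∀ (φ : Module.Dual K N) (y : N'), φ (f0 y) = (g (StdDual.of A φ)).toDual y :=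
    fun φ y => Module.apply_evalEquiv_symm_apply _ _ φ _
  refine ⟨{ toFun := f0, map_add' := fun y z => ?_, map_smul' := fun a y => ?_ }, ?_⟩
  · refine eq_of_forall_dual (K := K) fun φ => ?_
    rw [map_add, hf, hf, hf, map_add]
  · refine eq_of_forall_dual (K := K) fun φ => ?_
    have h1 : φ (a • f0 y) = (a.unop • StdDual.of A φ).toDual (f0 y) := rfl
    have h2 : (g (StdDual.of A φ)).toDual (a • y) =
      (a.unop • g (StdDual.of A φ)).toDual y := rfl
    rw [RingHom.id_apply, hf, h1, h2, ← map_smul]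
    exact (hf (a.unop • StdDual.of A φ).toDual y).symm
  · intro y z hyz
    refine eq_of_forall_dual (K := K) fun φ => ?_
    obtain ⟨ψ, hψ⟩ := hg (StdDual.of A φ)
    have h1 := hf ψ.toDual y
    have h2 := hf ψ.toDual z
    have h3 : f0 y = f0 z := hyz
    rw [h3, h2] at h1
    have h4 : g (StdDual.of A ψ.toDual) = StdDual.of A φ := hψ
    rw [h4] at h1
    exact h1.symm

/-- If the dual of `N` has a simple top, every nonzero submodule of `N` contains every element
that generates a one-dimensional submodule. -/
theorem mem_span_of_isCoatom_jacobson [FiniteDimensional K N]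
    (hco : IsCoatom (Module.jacobson A (StdDual K A N))) {s : N} (hs : s ≠ 0)
    (hs' : ∀ a : Aᵐᵒᵖ, ∃ c : K, a • s = c • s) {y : N} (hy : y ≠ 0) :
    s ∈ Submodule.span Aᵐᵒᵖ {y} := by
  have : IsNoetherian A (StdDual K A N) := isNoetherian_of_tower K inferInstance
  -- The annihilator of s. It is a submodule because s spans a line stable under the action, and it
  -- is maximal because it has codimension one.
  let S : Submodule A (StdDual K A N) :=
    { carrier := {φ | φ.toDual s = 0}
      add_mem' := fun {φ ψ} hφ hψ => by
        change φ.toDual s + ψ.toDual s = 0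
        rw [hφ, hψ, add_zero]
      zero_mem' := rfl
      smul_mem' := fun a φ hφ => by
        obtain ⟨c, hc⟩ := hs' (MulOpposite.op a)
        change φ.toDual (MulOpposite.op a • s) = 0
        rw [hc, map_smul, show φ.toDual s = 0 from hφ, smul_zero] }
  -- The annihilator of the submodule generated by y. Being proper, it lies in a maximal submodule,
  -- which must be S; separating s from that submodule by a functional then gives a contradiction.
  let Y : Submodule A (StdDual K A N) :=
    { carrier := {φ | ∀ a : Aᵐᵒᵖ, φ.toDual (a • y) = 0}
      add_mem' := fun {φ ψ} hφ hψ a => by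
        change φ.toDual (a • y) + ψ.toDual (a • y) = 0
        rw [hφ, hψ, add_zero]
      zero_mem' := fun _ => rfl
      smul_mem' := fun b φ hφ a => by
        change φ.toDual (MulOpposite.op b • a • y) = 0
        rw [smul_smul, hφ] }
  obtain ⟨φ₀, hφ₀⟩ : ∃ φ : Module.Dual K N, φ s ≠ 0 := by
    by_contra! hc
    exact hs ((Module.forall_dual_apply_eq_zero_iff K s).1 hc)
  have hS : IsCoatom S := by
    refine ⟨fun ht => hφ₀ (show StdDual.of A φ₀ ∈ S from ht ▸ Submodule.mem_top), fun L hL => ?_⟩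
    obtain ⟨φ, hφL, hφ⟩ := Set.exists_of_ssubset hL
    have hφ : φ.toDual s ≠ 0 := hφ
    refine (Submodule.eq_top_iff').2 fun ψ => ?_
    have h1 : ψ - (ψ.toDual s / φ.toDual s) • φ ∈ S := by
      change ψ.toDual s - (ψ.toDual s / φ.toDual s) • φ.toDual s = 0
      rw [smul_eq_mul, div_mul_cancel₀ _ hφ, sub_self]
    have h2 := L.add_mem (hL.le h1) (L.smul_of_tower_mem (ψ.toDual s / φ.toDual s) hφL)
    rwa [sub_add_cancel] at h2
  have hY : Y ≠ ⊤ := by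
    intro ht
    refine hy ((Module.forall_dual_apply_eq_zero_iff K y).1 fun φ => ?_)
    have : StdDual.of A φ ∈ Y := ht ▸ Submodule.mem_top
    have := this 1
    rwa [one_smul] at this
  have hle : ∀ {L : Submodule A (StdDual K A N)}, IsCoatom L →
      Module.jacobson A (StdDual K A N) = L := fun {L} hL =>
    (sInf_le (show L ∈ {m : Submodule A (StdDual K A N) | IsCoatom m} from hL)).eq_of_not_lt
      fun hlt => hL.1 (hco.2 _ hlt)
  obtain ⟨L, hL, hYL⟩ := (eq_top_or_exists_le_coatom Y).resolve_left hY
  rw [← hle hL, hle hS] at hYL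
  by_contra hns
  obtain ⟨φ, hφ, hφ'⟩ := Submodule.exists_dual_map_eq_bot_of_notMem
    (p := (Submodule.span Aᵐᵒᵖ {y}).restrictScalars K) hns inferInstance
  refine hφ (hYL (x := StdDual.of A φ) fun a => ?_)
  have : φ (a • y) ∈ ((Submodule.span Aᵐᵒᵖ {y}).restrictScalars K).map φ :=
    ⟨_, Submodule.smul_mem _ a (Submodule.mem_span_singleton_self y), rfl⟩
  rwa [hφ', Submodule.mem_bot] at this

/-- If `M` has a simple socle, every nonzero submodule of `M` contains every element that
generates a one-dimensional submodule. -/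
theorem mem_span_of_isSimpleModule_socle {M : Type w} [AddCommGroup M] [Module K M] [Module A M]
    [IsScalarTower K A M] [FiniteDimensional K M] (hsoc : IsSimpleModule A (socle A M)) {s : M}
    (hs : s ≠ 0) (hs' : ∀ a : A, ∃ c : K, a • s = c • s) {y : M} (hy : y ≠ 0) :
    s ∈ Submodule.span A {y} := by
  have : IsArtinian A M := isArtinian_of_tower K inferInstance
  have hat : IsAtom (Submodule.span A {s}) := by
    refine ⟨by simpa using hs, fun L hL => ?_⟩
    by_contra hL0
    obtain ⟨z, hzL, hz⟩ := Submodule.exists_mem_ne_zero_of_ne_bot hL0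
    obtain ⟨a, rfl⟩ := Submodule.mem_span_singleton.1 (hL.le hzL)
    obtain ⟨c, hc⟩ := hs' a
    rw [hc] at hzL hz
    have hc0 : c ≠ 0 := by
      rintro rfl
      exact hz (zero_smul _ _)
    refine hL.not_ge ((Submodule.span_singleton_le_iff_mem _ _).2 ?_)
    have := L.smul_of_tower_mem c⁻¹ hzL
    rwa [smul_smul, inv_mul_cancel₀ hc0, one_smul] at this
  obtain ⟨T, hT, hTy⟩ := (eq_bot_or_exists_atom_le (Submodule.span A {y})).resolve_left
    (by simpa using hy)
  have hsoc' := (isSimpleModule_iff_isAtom).1 hsoc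
  have hle : ∀ {L : Submodule A M}, IsAtom L → L = socle A M := fun {L} hL =>
    (le_sSup (show L ∈ {N : Submodule A M | IsSimpleModule A N} from
      isSimpleModule_iff_isAtom.2 hL)).eq_of_not_lt fun hlt => hL.1 (hsoc'.2 _ hlt)
  rw [hle hT, ← hle hat] at hTy
  exact hTy (Submodule.mem_span_singleton_self s)

end Duality

/-! ### The distinguished elements of a 1-quasi-hereditary algebra -/

section PeakSystem

variable {K : Type u} [Field K] {A : Type v} [Ring A] [Algebra K A] {Λ : Type x} [Fintype Λ]
  [PartialOrder Λ] [BoundedOrder Λ] {e : Λ → A} {r : Submodule K A}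

open Classical in
/-- Elements `v i` and `w i` that span `e i * A * e ⊤` and `e ⊤ * A * e i`. Right multiplication
by `v i` embeds `Δ(i)` into `Δ(⊤)`, and left multiplication by `w i` embeds the standard module
of the opposite algebra at `i` into the one at `⊤`. -/
structure IsPeakSystem (K : Type u) [Field K] {A : Type v} [Ring A] [Algebra K A] {Λ : Type x}
    [Fintype Λ] [PartialOrder Λ] [BoundedOrder Λ] (e : Λ → A) (v w : Λ → A) : Prop where
  v_mem : ∀ i, v i ∈ corner K e i ⊤
  w_mem : ∀ i, w i ∈ corner K e ⊤ i
  finrank_corner : ∀ k j,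
    Module.finrank K (corner K e k j) = Finset.card {i : Λ | k ≤ i ∧ j ≤ i}
  mem_of_mul_v : ∀ {i k : Λ} {y : A}, y ∈ corner K e k i → y * v i = 0 →
    y ∈ ⨆ (m : Λ) (_ : i < m), corner K e k m * corner K e m i
  mul_v_eq_zero : ∀ {i k : Λ} {y : A}, ¬ k ≤ i → y ∈ corner K e k i → y * v i = 0
  mem_of_w_mul : ∀ {i k : Λ} {y : A}, y ∈ corner K e i k → w i * y = 0 →
    y ∈ ⨆ (m : Λ) (_ : i < m), corner K e i m * corner K e m k
  w_mul_eq_zero : ∀ {i k : Λ} {y : A}, ¬ k ≤ i → y ∈ corner K e i k → w i * y = 0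
  v_mul_w_ne_zero : ∀ j k, v j * w k ≠ 0
  exists_mul_eq : ∀ {j : Λ} {y : A}, y * e j = y → y ≠ 0 → ∃ a, a * y = v ⊥ * w j
  exists_eq_mul : ∀ {j : Λ} {y : A}, e j * y = y → y ≠ 0 → ∃ a, y * a = v j * w ⊥

theorem finrank_corner_top (h : IsSplitBasic e r) (hA : IsOneQuasiHereditary K e)
    [FiniteDimensional K A] (k : Λ) :
    Module.finrank K (corner K e k ⊤) = 1 ∧ Module.finrank K (corner K e ⊤ k) = 1 := by
  classical
  constructor
  all_goals
    rw [finrank_corner_eq h hA, Finset.card_eq_one]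
    refine ⟨⊤, ?_⟩
    ext i
    simp only [Finset.mem_filter, Finset.mem_univ, true_and, top_le_iff, Finset.mem_singleton]
    first
    | exact ⟨fun h => h.2, fun h => ⟨h ▸ le_top, h⟩⟩
    | exact ⟨fun h => h.1, fun h => ⟨h, h ▸ le_top⟩⟩

omit [Fintype Λ] [PartialOrder Λ] [BoundedOrder Λ] in
theorem exists_smul_eq {k j : Λ} (h : Module.finrank K (corner K e k j) = 1) {v y : A}
    (hv : v ∈ corner K e k j) (hv0 : v ≠ 0) (hy : y ∈ corner K e k j) : ∃ c : K, y = c • v := by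
  obtain ⟨c, hc⟩ := (finrank_eq_one_iff_of_nonzero' (⟨v, hv⟩ : corner K e k j)
    (fun h0 => hv0 (congrArg Subtype.val h0))).1 h ⟨y, hy⟩
  exact ⟨c, (congrArg Subtype.val hc).symm⟩

omit [Fintype Λ] [PartialOrder Λ] [BoundedOrder Λ] in
theorem op_mem_corner {i j : Λ} {a : Aᵐᵒᵖ} :
    a ∈ corner K (opIdem e) i j ↔ a.unop ∈ corner K e j i := by
  constructor
  · rintro ⟨h1, h2⟩
    exact ⟨congrArg MulOpposite.unop h2, congrArg MulOpposite.unop h1⟩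
  · rintro ⟨h1, h2⟩
    exact ⟨MulOpposite.unop_injective h2, MulOpposite.unop_injective h1⟩

/-- A product through l ≰ i can be rerouted through common upper bounds m of l and i, and m ≠ i
because l ≰ i. -/
theorem iSup_corner_le (h : IsSplitBasic e r) (hA : IsOneQuasiHereditary K e)
    [FiniteDimensional K A] (k i : Λ) :
    (⨆ (l : Λ) (_ : ¬ l ≤ i), corner K e k l * corner K e l i) ≤
      ⨆ (m : Λ) (_ : i < m), corner K e k m * corner K e m i := by
  refine iSup₂_le fun l hl => (mul_le_mul_right (corner_le h hA l i) _).trans ?_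
  simp only [Submodule.mul_iSup]
  refine iSup₂_le fun m hm => ?_
  have him : i < m := hm.2.lt_of_ne (by rintro rfl; exact hl hm.1)
  rw [← mul_assoc]
  exact (mul_le_mul_left (corner_mul_le k l m) _).trans
    (le_iSup₂ (f := fun (m : Λ) (_ : i < m) => corner K e k m * corner K e m i) m him)

theorem iSup_corner_le' (h : IsSplitBasic e r) (hA : IsOneQuasiHereditary K e)
    [FiniteDimensional K A] (k i : Λ) :
    (⨆ (l : Λ) (_ : ¬ l ≤ i), corner K e i l * corner K e l k) ≤
      ⨆ (m : Λ) (_ : i < m), corner K e i m * corner K e m k := by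
  refine iSup₂_le fun l hl => (mul_le_mul_left (corner_le h hA i l) _).trans ?_
  simp only [Submodule.iSup_mul]
  refine iSup₂_le fun m hm => ?_
  have him : i < m := hm.1.lt_of_ne (by rintro rfl; exact hl hm.2)
  rw [mul_assoc]
  exact (mul_le_mul_right (corner_mul_le m l k) _).trans
    (le_iSup₂ (f := fun (m : Λ) (_ : i < m) => corner K e i m * corner K e m k) m him)

omit [BoundedOrder Λ] in
-- Otherwise e_i would be a sum of products through vertices l ≠ i, all of which lie in r.
theorem projGen_notMem_stdKer (h : IsSplitBasic e r) [FiniteDimensional K A] (i : Λ) :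
    projGen e i ∉ stdKer e i := by
  intro hi
  have h1 := h.mem_of_mem_stdKer (k := i) hi (h.idem.idem i)
  refine h.notMem i ((iSup₂_le fun l hl => Submodule.mul_le.2 fun a ha b _ => ?_ :
    (⨆ (l : Λ) (_ : ¬ l ≤ i), corner K e i l * corner K e l i) ≤ r) h1)
  refine h.mul_right _ _ ?_
  rw [← ha.2, ← ha.1]
  exact h.off_diag i l a fun hil => hl hil.ge

theorem exists_isPeakSystem (h : IsSplitBasic e r) (hA : IsOneQuasiHereditary K e)
    [FiniteDimensional K A] : ∃ v w : Λ → A, IsPeakSystem K e v w := by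
  have hop := h.op
  have hv := fun i => h.exists_mul_eq_zero_iff_mem_stdKer (hA.std_embeds i).choose_spec
  choose v hv hvk using hv
  -- Dualizing ∇(⊤) → ∇(i) gives an embedding of standard modules over the opposite algebra, so w_i
  -- arises just as v_i does.
  have hw : ∀ i, ∃ w ∈ corner K (opIdem e) i ⊤,
      ∀ y : proj (opIdem e) i, (y : Aᵐᵒᵖ) * w = 0 ↔ y ∈ stdKer (opIdem e) i := by
    intro i
    obtain ⟨g, hg⟩ := hA.costd_surjects i
    obtain ⟨f, hf⟩ := exists_injective_of_surjective_stdDual g hg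
    exact hop.exists_mul_eq_zero_iff_mem_stdKer hf
  choose w' hw' hwk using hw
  have hw : ∀ i, (w' i).unop ∈ corner K e ⊤ i := fun i => op_mem_corner.1 (hw' i)
  have hv0 : ∀ i, v i ≠ 0 := fun i hi =>
    projGen_notMem_stdKer h i ((hvk i _).1 (by rw [hi, mul_zero]))
  have hw0 : ∀ i, (w' i).unop ≠ 0 := fun i hi =>
    projGen_notMem_stdKer hop i ((hwk i _).1 (by
      rw [(MulOpposite.unop_eq_zero_iff _).1 hi, mul_zero]))
  have hvz : ∀ {i k : Λ} {y : A}, ¬ k ≤ i → y ∈ corner K e k i → y * v i = 0 :=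
    fun {i k y} hk hy => (hvk i ⟨y, mem_proj_of_mem_corner hy⟩).2 (h.mem_stdKer hk hy.1)
  have hwz : ∀ {i k : Λ} {y : A}, ¬ k ≤ i → y ∈ corner K e i k → (w' i).unop * y = 0 := by
    intro i k y hk hy
    have hy' : MulOpposite.op y ∈ corner K (opIdem e) k i := op_mem_corner.2 hy
    exact congrArg MulOpposite.unop
      ((hwk i ⟨_, mem_proj_of_mem_corner hy'⟩).2 (hop.mem_stdKer hk hy'.1))
  -- The line e_⊤Ae_k contains an element with zero annihilator in P(⊤); w_k is proportional to it,
  -- and v_j lies in P(⊤).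
  have hvw : ∀ j k, v j * (w' k).unop ≠ 0 := by
    intro j k h0
    obtain ⟨z, hz, hz'⟩ := exists_top_generator h hA k
    obtain ⟨c, rfl⟩ := exists_smul_eq (finrank_corner_top h hA k).2 (hw k) (hw0 k) hz
    refine hv0 j (hz' _ (mem_proj_of_mem_corner (hv j)) ?_)
    rw [mul_smul_comm, h0, smul_zero]
  -- A v_⊥ is a line: components at k ≠ ⊥ vanish since k ≰ ⊥, and e_⊥Ae_⊤ is one-dimensional. Thus
  -- v_⊥ w_j spans a simple submodule of P(j), which is its socle.
  have hvs : ∀ a : A, ∃ c : K, a * v ⊥ = c • v ⊥ := by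
    intro a
    obtain ⟨c, hc⟩ := exists_smul_eq (finrank_corner_top h hA ⊥).1 (hv ⊥) (hv0 ⊥)
      (mul_mem_corner (mul_mul_mem_corner h.idem ⊥ ⊥ a) (hv ⊥))
    refine ⟨c, ?_⟩
    rw [← hc, ← one_mul (a * v ⊥), ← h.idem.complete, Finset.sum_mul,
      Finset.sum_eq_single ⊥ _ (by simp), mul_assoc, mul_assoc, (hv ⊥).1]
    intro k _ hk
    have := hvz (fun hk' => hk (le_bot_iff.1 hk')) (mul_mul_mem_corner (K := K) h.idem k ⊥ a)
    rwa [mul_assoc, mul_assoc, (hv ⊥).1] at this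
  have hws : ∀ a : A, ∃ c : K, (w' ⊥).unop * a = c • (w' ⊥).unop := by
    intro a
    obtain ⟨c, hc⟩ := exists_smul_eq (finrank_corner_top h hA ⊥).2 (hw ⊥) (hw0 ⊥)
      (mul_mem_corner (hw ⊥) (mul_mul_mem_corner h.idem ⊥ ⊥ a))
    refine ⟨c, ?_⟩
    rw [← hc, ← mul_one ((w' ⊥).unop * a), ← h.idem.complete, Finset.mul_sum,
      Finset.sum_eq_single ⊥ _ (by simp), ← mul_assoc, ← mul_assoc, (hw ⊥).2]
    intro k _ hk
    have := hwz (fun hk' => hk (le_bot_iff.1 hk')) (mul_mul_mem_corner (K := K) h.idem ⊥ k a)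
    rwa [← mul_assoc, ← mul_assoc, (hw ⊥).2] at this
  have hsimple : IsSimpleModule A (simple e ⊥) := by
    rw [isSimpleModule_iff_isCoatom, h.jacobson_proj]
    exact (isCoatom_iff_of_forall_le_or_eq_top (h.radProj_ne_top ⊥)
      (h.le_radProj_or_eq_top ⊥) _).2 rfl
  refine ⟨v, fun i => (w' i).unop, hv, hw, finrank_corner_eq h hA, ?_, hvz, ?_, hwz, hvw, ?_, ?_⟩
  · intro i k y hy hy0
    exact iSup_corner_le h hA k i (h.mem_of_mem_stdKer
      ((hvk i ⟨y, mem_proj_of_mem_corner hy⟩).1 hy0) hy.1)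
  · intro i k y hy hy0
    have hy' : MulOpposite.op y ∈ corner K (opIdem e) k i := op_mem_corner.2 hy
    have h1 := hop.mem_of_mem_stdKer
      ((hwk i ⟨_, mem_proj_of_mem_corner hy'⟩).1 (MulOpposite.unop_injective hy0)) hy'.1
    refine iSup_corner_le' h hA k i ((iSup₂_le fun l hl => Submodule.mul_le.2 fun a ha b hb => ?_ :
      (⨆ (l : Λ) (_ : ¬ l ≤ i), corner K (opIdem e) k l * corner K (opIdem e) l i) ≤
      (⨆ (l : Λ) (_ : ¬ l ≤ i), corner K e i l * corner K e l k).comap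
        (MulOpposite.opLinearEquiv K : A ≃ₗ[K] Aᵐᵒᵖ).symm.toLinearMap) h1)
    exact Submodule.mem_iSup_of_mem l (Submodule.mem_iSup_of_mem hl
      (Submodule.mul_mem_mul (op_mem_corner.1 hb) (op_mem_corner.1 ha)))
  · intro j y hy hy0
    have hs := IsSimpleModule.congr (hA.socle_proj j).some
    let s : proj e j := ⟨v ⊥ * (w' j).unop, mem_proj_of_mem_corner (mul_mem_corner (hv ⊥) (hw j))⟩
    have h1 := mem_span_of_isSimpleModule_socle (K := K) hs (s := s)
      (fun h0 => hvw ⊥ j (congrArg Subtype.val h0)) (fun a => by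
        obtain ⟨c, hc⟩ := hvs a
        refine ⟨c, Subtype.ext ?_⟩
        change a * (v ⊥ * (w' j).unop) = c • (v ⊥ * (w' j).unop)
        rw [← mul_assoc, hc, smul_mul_assoc])
      (y := ⟨y, mem_proj_of_mul_e hy⟩) (fun h0 => hy0 (congrArg Subtype.val h0))
    obtain ⟨a, ha⟩ := Submodule.mem_span_singleton.1 h1
    exact ⟨a, congrArg Subtype.val ha⟩
  · intro j y hy hy0
    have hs := isSimpleModule_iff_isCoatom.1 (IsSimpleModule.congr (hA.top_inj j).some)
    let s : proj (opIdem e) j := ⟨MulOpposite.op (v j * (w' ⊥).unop), mem_proj_of_mem_corner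
      (op_mem_corner.2 (mul_mem_corner (hv j) (hw ⊥)))⟩
    have h1 := mem_span_of_isCoatom_jacobson (K := K) hs (s := s)
      (fun h0 => hvw j ⊥ (congrArg (fun z => MulOpposite.unop (Subtype.val z)) h0)) (fun a => by
        obtain ⟨c, hc⟩ := hws a.unop
        refine ⟨c, Subtype.ext (MulOpposite.unop_injective ?_)⟩
        change v j * (w' ⊥).unop * a.unop = c • (v j * (w' ⊥).unop)
        rw [mul_assoc, hc, mul_smul_comm])
      (y := ⟨MulOpposite.op y, mem_proj_of_mul_e (MulOpposite.unop_injective hy)⟩)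
      (fun h0 => hy0 (congrArg (fun z => MulOpposite.unop (Subtype.val z)) h0))
    obtain ⟨a, ha⟩ := Submodule.mem_span_singleton.1 h1
    exact ⟨a.unop, congrArg (fun z => MulOpposite.unop (Subtype.val z)) ha⟩

end PeakSystem

/-! ### Products through a vertex -/

namespace IsPeakSystem

variable {K : Type u} [Field K] {A : Type v} [Ring A] [Algebra K A] {Λ : Type x} [Fintype Λ]
  [PartialOrder Λ] [BoundedOrder Λ] {e : Λ → A} {v w d u : Λ → A}

theorem v_ne_zero (h : IsPeakSystem K e v w) (i : Λ) : v i ≠ 0 := fun h0 =>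
  h.v_mul_w_ne_zero i i (by rw [h0, zero_mul])

theorem w_ne_zero (h : IsPeakSystem K e v w) (i : Λ) : w i ≠ 0 := fun h0 =>
  h.v_mul_w_ne_zero i i (by rw [h0, mul_zero])

theorem exists_eq_smul_v (h : IsPeakSystem K e v w) {i : Λ} {y : A} (hy : y ∈ corner K e i ⊤) :
    ∃ c : K, y = c • v i := by
  classical
  refine exists_smul_eq ?_ (h.v_mem i) (h.v_ne_zero i) hy
  rw [h.finrank_corner, Finset.card_eq_one]
  refine ⟨⊤, ?_⟩
  ext j
  simp only [Finset.mem_filter, Finset.mem_univ, true_and, top_le_iff, Finset.mem_singleton]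
  exact ⟨fun h => h.2, fun h => ⟨h ▸ le_top, h⟩⟩

theorem exists_eq_smul_w (h : IsPeakSystem K e v w) {i : Λ} {y : A} (hy : y ∈ corner K e ⊤ i) :
    ∃ c : K, y = c • w i := by
  classical
  refine exists_smul_eq ?_ (h.w_mem i) (h.w_ne_zero i) hy
  rw [h.finrank_corner, Finset.card_eq_one]
  refine ⟨⊤, ?_⟩
  ext j
  simp only [Finset.mem_filter, Finset.mem_univ, true_and, top_le_iff, Finset.mem_singleton]
  exact ⟨fun h => h.1, fun h => ⟨h, h ▸ le_top⟩⟩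

/-- A nonzero y in e_iA can be multiplied on the right to v_i w_⊥, which a sends to a nonzero
multiple of v_⊥ w_⊥. -/
theorem eq_zero_of_mul_eq_zero (h : IsPeakSystem K e v w) {i : Λ} {a y : A}
    (ha : a ∈ corner K e ⊥ i) (hav : a * v i ≠ 0) (hy : e i * y = y) (hay : a * y = 0) :
    y = 0 := by
  by_contra hy0
  obtain ⟨b, hb⟩ := h.exists_eq_mul hy hy0
  obtain ⟨c, hc⟩ := h.exists_eq_smul_v (mul_mem_corner ha (h.v_mem i))
  have hc0 : c ≠ 0 := by
    rintro rfl
    exact hav (by rw [hc, zero_smul])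
  have h1 : a * y * b = c • (v ⊥ * w ⊥) := by
    rw [mul_assoc, hb, ← mul_assoc, hc, smul_mul_assoc]
  rw [hay, zero_mul] at h1
  exact smul_ne_zero hc0 (h.v_mul_w_ne_zero ⊥ ⊥) h1.symm

theorem eq_zero_of_mul_eq_zero' (h : IsPeakSystem K e v w) {i : Λ} {a y : A}
    (ha : a ∈ corner K e i ⊥) (hwa : w i * a ≠ 0) (hy : y * e i = y) (hya : y * a = 0) :
    y = 0 := by
  by_contra hy0
  obtain ⟨b, hb⟩ := h.exists_mul_eq hy hy0
  obtain ⟨c, hc⟩ := h.exists_eq_smul_w (mul_mem_corner (h.w_mem i) ha)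
  have hc0 : c ≠ 0 := by
    rintro rfl
    exact hwa (by rw [hc, zero_smul])
  have h1 : b * (y * a) = c • (v ⊥ * w ⊥) := by
    rw [← mul_assoc, hb, mul_assoc, hc, mul_smul_comm]
  rw [hya, mul_zero] at h1
  exact smul_ne_zero hc0 (h.v_mul_w_ne_zero ⊥ ⊥) h1.symm

/-- `e i * A * e ⊥` is generated by one element over `e ⊥ * A * e ⊥`. -/
theorem exists_eq_mul_corner [FiniteDimensional K A] (he : CompleteOrthogonalIdempotents e)
    (h : IsPeakSystem K e v w) {i : Λ} {a y : A} (ha : a ∈ corner K e i ⊥) (hwa : w i * a ≠ 0)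
    (hy : y ∈ corner K e i ⊥) : ∃ c ∈ corner K e ⊥ ⊥, y = a * c := by
  classical
  set S := (corner K e ⊥ ⊥).map (LinearMap.mulLeft K a) with hS
  suffices hyS : y ∈ S by
    obtain ⟨c, hc, hcy⟩ := hyS
    exact ⟨c, hc, hcy.symm⟩
  by_contra hyS
  obtain ⟨φ, hφy, hφS⟩ := Submodule.exists_dual_map_eq_bot_of_notMem hyS inferInstance
  obtain ⟨ψ, hψ⟩ : ∃ ψ : Module.Dual K A, ψ (v ⊥ * w ⊥) ≠ 0 := by
    by_contra! hc
    exact h.v_mul_w_ne_zero ⊥ ⊥ ((Module.forall_dual_apply_eq_zero_iff K _).1 hc)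
  have hvwe : v ⊥ * w ⊥ * e ⊥ = v ⊥ * w ⊥ := by rw [mul_assoc, (h.w_mem ⊥).2]
  -- A functional ψ nonzero on the socle element v_⊥ w_⊥ makes (x, z) ↦ ψ(xz) a perfect pairing of
  -- e_⊥Ae_i with e_iAe_⊥, so φ has the form ψ(x ·).
  let T : corner K e ⊥ i →ₗ[K] Module.Dual K (corner K e i ⊥) :=
    ((LinearMap.mul K A).compr₂ ψ).domRestrict₁₂ _ _
  have hT : ∀ (x : corner K e ⊥ i) (z : corner K e i ⊥), T x z = ψ (x * z) := fun _ _ => rfl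
  have hTinj : Function.Injective T := by
    refine (injective_iff_map_eq_zero T).2 fun x hx => ?_
    by_contra hx0
    obtain ⟨b, hb⟩ := h.exists_eq_mul x.2.1 (fun h0 => hx0 (Subtype.ext h0))
    have h1 := hT x ⟨_, mul_mul_mem_corner he i ⊥ b⟩
    rw [hx, LinearMap.zero_apply, ← mul_assoc, ← mul_assoc, x.2.2, hb, hvwe] at h1
    exact hψ h1.symm
  have hTsurj : Function.Surjective T := by
    refine (LinearMap.injective_iff_surjective_of_finrank_eq_finrank ?_).1 hTinj
    rw [Subspace.dual_finrank_eq, h.finrank_corner, h.finrank_corner]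
    congr 1
    ext j
    simp [and_comm]
  obtain ⟨x, hx⟩ := hTsurj (φ.domRestrict _)
  have hxφ : ∀ z ∈ corner K e i ⊥, φ z = ψ (x * z) := fun z hz =>
    (LinearMap.congr_fun hx ⟨z, hz⟩).symm
  -- If xa = 0 then x = 0 and φ(y) = 0. Otherwise xa divides v_⊥ w_⊥, although φ = ψ(x ·) vanishes
  -- on a e_⊥Ae_⊥.
  have hx0 : (x : A) * a ≠ 0 := by
    intro h0
    rw [hxφ y hy, h.eq_zero_of_mul_eq_zero' ha hwa x.2.2 h0, zero_mul, map_zero] at hφy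
    exact hφy rfl
  obtain ⟨b, hb⟩ := h.exists_eq_mul (mul_mem_corner x.2 ha).1 hx0
  have hc : e ⊥ * b * e ⊥ ∈ corner K e ⊥ ⊥ := mul_mul_mem_corner he ⊥ ⊥ b
  have h1 : φ (a * (e ⊥ * b * e ⊥)) ∈ S.map φ := ⟨_, ⟨_, hc, rfl⟩, rfl⟩
  rw [hφS, Submodule.mem_bot, hxφ _ (mul_mem_corner ha hc), ← mul_assoc, ← mul_assoc, ← mul_assoc,
    mul_assoc (x : A) a (e ⊥), ha.2, hb, hvwe] at h1
  exact hψ h1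

/-- Given x and y, scalars α, β make x - αa killed by v_i and y - βb killed by w_i, so both
differences factor through vertices above i. -/
theorem corner_mul_corner_le (h : IsPeakSystem K e v w) {i : Λ} {a b : A}
    (ha : a ∈ corner K e ⊥ i) (hav : a * v i ≠ 0) (hb : b ∈ corner K e i ⊥) (hwb : w i * b ≠ 0) :
    corner K e ⊥ i * corner K e i ⊥ ≤ Submodule.span K {a * b} ⊔
      ⨆ (m : Λ) (_ : i < m), corner K e ⊥ m * corner K e m ⊥ := by
  refine Submodule.mul_le.2 fun x hx y hy => ?_
  have hα : ∃ α : K, x * v i = α • (a * v i) :=  by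
    obtain ⟨c, hc⟩ := h.exists_eq_smul_v (mul_mem_corner ha (h.v_mem i))
    obtain ⟨c', hc'⟩ := h.exists_eq_smul_v (mul_mem_corner hx (h.v_mem i))
    have hc0 : c ≠ 0 := by
      rintro rfl
      exact hav (by rw [hc, zero_smul])
    exact ⟨c' * c⁻¹, by rw [hc', hc, smul_smul, inv_mul_cancel_right₀ hc0]⟩
  have hβ : ∃ β : K, w i * y = β • (w i * b) :=  by
    obtain ⟨c, hc⟩ := h.exists_eq_smul_w (mul_mem_corner (h.w_mem i) hb)
    obtain ⟨c', hc'⟩ := h.exists_eq_smul_w (mul_mem_corner (h.w_mem i) hy)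
    have hc0 : c ≠ 0 := by
      rintro rfl
      exact hwb (by rw [hc, zero_smul])
    exact ⟨c' * c⁻¹, by rw [hc', hc, smul_smul, inv_mul_cancel_right₀ hc0]⟩
  obtain ⟨α, hα⟩ := hα
  obtain ⟨β, hβ⟩ := hβ
  have h1 := h.mem_of_mul_v (Submodule.sub_mem _ hx (Submodule.smul_mem _ α ha))
    (by rw [sub_mul, hα, smul_mul_assoc, sub_self])
  have h2 := h.mem_of_w_mul (Submodule.sub_mem _ hy (Submodule.smul_mem _ β hb))
    (by rw [mul_sub, hβ, mul_smul_comm, sub_self])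
  have h3 : x * y = (α * β) • (a * b) + ((x - α • a) * y + α • (a * (y - β • b))) := by
    rw [sub_mul, mul_sub, smul_sub, mul_smul_comm, smul_mul_assoc, smul_smul]
    abel
  rw [h3]
  refine Submodule.add_mem_sup (Submodule.smul_mem _ _ (Submodule.mem_span_singleton_self _))
    (Submodule.add_mem _ ?_ (Submodule.smul_mem _ _ ?_))
  · have h4 := Submodule.mul_mem_mul h1 hy
    simp only [Submodule.iSup_mul] at h4
    refine (?_ : (_ : Submodule K A) ≤ _) h4
    refine iSup₂_mono fun m _ => ?_
    rw [mul_assoc]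
    exact mul_le_mul_right (corner_mul_le m i ⊥) _
  · have h4 := Submodule.mul_mem_mul ha h2
    simp only [Submodule.mul_iSup] at h4
    refine (?_ : (_ : Submodule K A) ≤ _) h4
    refine iSup₂_mono fun m _ => ?_
    rw [← mul_assoc]
    exact mul_le_mul_left (corner_mul_le ⊥ i m) _

variable (h : IsPeakSystem K e v w) (hd : ∀ i, d i ∈ corner K e ⊥ i) (hdv : ∀ i, d i * v i ≠ 0)
  (hu : ∀ i, u i ∈ corner K e i ⊥) (hwu : ∀ i, w i * u i ≠ 0)

include h hd hdv hu hwu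

theorem corner_mul_corner_le_span (i : Λ) : corner K e ⊥ i * corner K e i ⊥ ≤
    Submodule.span K ((fun m => d m * u m) '' Set.Ici i) := by
  induction i using WellFoundedGT.induction with
  | ind i ih =>
    refine (h.corner_mul_corner_le (hd i) (hdv i) (hu i) (hwu i)).trans (sup_le ?_ ?_)
    · exact Submodule.span_mono (Set.singleton_subset_iff.2 ⟨i, Set.self_mem_Ici, rfl⟩)
    · exact iSup₂_le fun m hm => (ih m hm).trans
        (Submodule.span_mono (Set.image_mono (Set.Ici_subset_Ici.2 hm.le)))

theorem iSup_corner_mul_corner_le_span (i : Λ) :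
    (⨆ (m : Λ) (_ : i < m), corner K e ⊥ m * corner K e m ⊥) ≤
      Submodule.span K ((fun m => d m * u m) '' Set.Ioi i) :=
  iSup₂_le fun m hm => (h.corner_mul_corner_le_span hd hdv hu hwu m).trans
    (Submodule.span_mono (Set.image_mono (Set.Ici_subset_Ioi.2 hm)))

/-- The products span e_⊥Ae_⊥, whose dimension is the number of vertices. -/
theorem linearIndependent [FiniteDimensional K A] (he : CompleteOrthogonalIdempotents e) :
    LinearIndependent K fun m => d m * u m := by
  classical
  rw [linearIndependent_iff_card_le_finrank_span, Set.finrank]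
  have h1 : corner K e ⊥ ⊥ ≤ Submodule.span K (Set.range fun m => d m * u m) := by
    intro y hy
    have h2 := h.corner_mul_corner_le_span hd hdv hu hwu ⊥
      (Submodule.mul_mem_mul (e_mem_corner he ⊥) hy)
    rw [hy.1, Set.Ici_bot, Set.image_univ] at h2
    exact h2
  refine le_trans ?_ (Submodule.finrank_mono h1)
  rw [h.finrank_corner]
  simp

/-- One inclusion is known. Left multiplication by d_i is injective, so the left side has dimension
#{j ≥ i}, and the right side is spanned by at most that many elements. -/
theorem map_mulLeft_corner [FiniteDimensional K A] (i : Λ) :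
    (corner K e i ⊥).map (LinearMap.mulLeft K (d i)) =
      Submodule.span K ((fun m => d m * u m) '' Set.Ici i) := by
  classical
  refine Submodule.eq_of_le_of_finrank_le ?_ ?_
  · rintro _ ⟨y, hy, rfl⟩
    exact h.corner_mul_corner_le_span hd hdv hu hwu i (Submodule.mul_mem_mul (hd i) hy)
  · have h1 : Module.finrank K ((corner K e i ⊥).map (LinearMap.mulLeft K (d i))) =
        Module.finrank K (corner K e i ⊥) := by
      rw [← LinearMap.range_domRestrict]
      refine LinearMap.finrank_range_of_inj ((injective_iff_map_eq_zero _).2 fun y hy => ?_)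
      exact Subtype.ext (h.eq_zero_of_mul_eq_zero (hd i) (hdv i) y.2.1 hy)
    rw [h1, h.finrank_corner]
    refine (finrank_span_le_card _).trans ?_
    rw [Set.toFinset_image]
    refine Finset.card_image_le.trans (Finset.card_le_card fun j hj => ?_)
    simpa using hj

/-- The scalar by which g acts on the line of w_⊥ is nilpotent, hence zero. As w_i u_i is a multiple
of w_⊥, the element u_i g is killed by w_i and factors through larger vertices. -/
theorem mul_mem_span_Ioi (i : Λ) {g : A} (hg : g ∈ corner K e ⊥ ⊥) (hg' : IsNilpotent g) :
    d i * u i * g ∈ Submodule.span K ((fun m => d m * u m) '' Set.Ioi i) := by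
  obtain ⟨c, hc⟩ := h.exists_eq_smul_w (mul_mem_corner (h.w_mem ⊥) hg)
  have hpow : ∀ n : ℕ, w ⊥ * g ^ n = c ^ n • w ⊥ := by
    intro n
    induction n with
    | zero => simp
    | succ n ih => rw [pow_succ, ← mul_assoc, ih, smul_mul_assoc, hc, smul_smul, pow_succ]
  have hc0 : c = 0 := by
    obtain ⟨n, hn⟩ := hg'
    have h1 := hpow n
    rw [hn, mul_zero, eq_comm, smul_eq_zero] at h1
    exact eq_zero_of_pow_eq_zero (h1.resolve_right (h.w_ne_zero ⊥))
  obtain ⟨c', hc'⟩ := h.exists_eq_smul_w (mul_mem_corner (h.w_mem i) (hu i))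
  have h2 := h.mem_of_w_mul (mul_mem_corner (hu i) hg) (by
    rw [← mul_assoc, hc', smul_mul_assoc, hc, hc0, zero_smul, smul_zero])
  refine h.iSup_corner_mul_corner_le_span hd hdv hu hwu i ?_
  have h3 := Submodule.mul_mem_mul (hd i) h2
  simp only [Submodule.mul_iSup] at h3
  rw [mul_assoc]
  refine (?_ : (_ : Submodule K A) ≤ _) h3
  refine iSup₂_mono fun m _ => ?_
  rw [← mul_assoc]
  exact mul_le_mul_left (corner_mul_le ⊥ i m) _

end IsPeakSystem

/-! ### Left ideals of the endomorphism algebra -/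

section EndAlgebra

variable {A : Type v} [Ring A] {Λ : Type x} [Fintype Λ] {e : Λ → A}

theorem coe_end_apply (he : CompleteOrthogonalIdempotents e) {i : Λ}
    (F : Module.End A (proj e i)) (y : proj e i) :
    (F y : A) = y * (F (projGen e i) : A) := by
  conv_lhs => rw [← smul_projGen he y, map_smul]
  rfl

theorem end_ext (he : CompleteOrthogonalIdempotents e) {i : Λ} {F G : Module.End A (proj e i)}
    (h : (F (projGen e i) : A) = G (projGen e i)) : F = G :=
  LinearMap.ext fun y => Subtype.ext (by rw [coe_end_apply he, h, ← coe_end_apply he])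

theorem end_mem_corner {K : Type u} [Field K] [Algebra K A] (he : CompleteOrthogonalIdempotents e)
    {i : Λ} (F : Module.End A (proj e i)) : (F (projGen e i) : A) ∈ corner K e i i :=
  ⟨(coe_end_apply he F (projGen e i)).symm, mul_e_of_mem_proj he (F (projGen e i)).2⟩

theorem mul_end_apply_projGen (he : CompleteOrthogonalIdempotents e) {i : Λ}
    (F G : Module.End A (proj e i)) :
    ((F * G) (projGen e i) : A) = (G (projGen e i) : A) * (F (projGen e i) : A) :=
  coe_end_apply he F _

end EndAlgebra

section PeakIdeals

variable {K : Type u} [Field K] {A : Type v} [Ring A] [Algebra K A] [FiniteDimensional K A]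
  {Λ : Type x} [Fintype Λ] [PartialOrder Λ] [BoundedOrder Λ] {e : Λ → A} {r : Submodule K A}
  {v w d u : Λ → A} {f : Λ → Module.End A (proj e (⊥ : Λ))}
  (hs : IsSplitBasic e r) (h : IsPeakSystem K e v w)
  (hd : ∀ i, d i ∈ corner K e ⊥ i) (hdv : ∀ i, d i * v i ≠ 0)
  (hu : ∀ i, u i ∈ corner K e i ⊥) (hwu : ∀ i, w i * u i ≠ 0)
  (hf : ∀ i, (f i (projGen e ⊥) : A) = d i * u i)

include hs h hd hdv hu hwu hf

/-- Evaluation at e_⊥ turns B∘f_i into d_i u_i e_⊥Ae_⊥, which equals d_i e_iAe_⊥ by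
`exists_eq_mul_corner`. -/
theorem mem_span_iff (i : Λ) (F : Module.End A (proj e (⊥ : Λ))) :
    F ∈ Ideal.span {f i} ↔
      (F (projGen e ⊥) : A) ∈ Submodule.span K ((fun m => d m * u m) '' Set.Ici i) := by
  rw [← h.map_mulLeft_corner hd hdv hu hwu i, Ideal.mem_span_singleton']
  constructor
  · rintro ⟨G, rfl⟩
    rw [mul_end_apply_projGen hs.idem, hf, mul_assoc]
    exact ⟨_, mul_mem_corner (hu i) (end_mem_corner hs.idem G), rfl⟩
  · rintro ⟨y, hy, hyF⟩
    obtain ⟨c, hc, rfl⟩ := h.exists_eq_mul_corner hs.idem (hu i) (hwu i) hy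
    refine ⟨projLift e ⊥ ⟨c, mem_proj_of_mem_corner hc⟩, end_ext hs.idem ?_⟩
    rw [mul_end_apply_projGen hs.idem, hf, ← hyF, LinearMap.mulLeft_apply, ← mul_assoc]
    exact congrArg _ hc.1

theorem isTwoSided_span (i : Λ) : (Ideal.span {f i}).IsTwoSided := by
  refine ⟨fun {F} G hF => ?_⟩
  rw [mem_span_iff hs h hd hdv hu hwu hf] at hF ⊢
  rw [mul_end_apply_projGen hs.idem]
  have hG : (G (projGen e ⊥) : A) ∈ corner K e ⊥ ⊥ := end_mem_corner hs.idem G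
  refine (Submodule.span_le.2 ?_ : Submodule.span K ((fun m => d m * u m) '' Set.Ici i) ≤
    (Submodule.span K ((fun m => d m * u m) '' Set.Ici i)).comap
      (LinearMap.mulLeft K (G (projGen e ⊥) : A))) hF
  rintro _ ⟨m, hm, rfl⟩
  refine Submodule.span_mono (Set.image_mono (Set.Ici_subset_Ici.2 hm))
    (h.corner_mul_corner_le_span hd hdv hu hwu m ?_)
  rw [LinearMap.mulLeft_apply, ← mul_assoc]
  exact Submodule.mul_mem_mul (mul_mem_corner hG (hd m)) (hu m)

theorem span_le_span {i i' : Λ} (hi : i ≤ i') : Ideal.span {f i'} ≤ Ideal.span {f i} := by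
  intro F hF
  rw [mem_span_iff hs h hd hdv hu hwu hf] at hF ⊢
  exact Submodule.span_mono (Set.image_mono (Set.Ici_subset_Ici.2 hi)) hF

omit [FiniteDimensional K A] in
-- The span of the d_m u_m with m > i is stable under right multiplication by e_⊥Ae_⊥, so it defines
-- a left ideal `W` containing the generators. Conversely, scalars of K act through B.
theorem mem_iSup_span_iff (i : Λ) (F : Module.End A (proj e (⊥ : Λ))) :
    F ∈ (⨆ (i' : Λ) (_ : i < i'), Ideal.span {f i'}) ↔
      (F (projGen e ⊥) : A) ∈ Submodule.span K ((fun m => d m * u m) '' Set.Ioi i) := by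
  constructor
  · let W : Ideal (Module.End A (proj e (⊥ : Λ))) :=
      { carrier := {F | (F (projGen e ⊥) : A) ∈
          Submodule.span K ((fun m => d m * u m) '' Set.Ioi i)}
        add_mem' := fun hF hG =>
          Submodule.add_mem (Submodule.span K ((fun m => d m * u m) '' Set.Ioi i)) hF hG
        zero_mem' := Submodule.zero_mem (Submodule.span K ((fun m => d m * u m) '' Set.Ioi i))
        smul_mem' := fun G F hF => by
          change (((G * F) (projGen e ⊥) : proj e (⊥ : Λ)) : A) ∈
            Submodule.span K ((fun m => d m * u m) '' Set.Ioi i)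
          rw [mul_end_apply_projGen hs.idem]
          refine (Submodule.span_le.2 ?_ :
            Submodule.span K ((fun m => d m * u m) '' Set.Ioi i) ≤
            (Submodule.span K ((fun m => d m * u m) '' Set.Ioi i)).comap
              (LinearMap.mulRight K (G (projGen e ⊥) : A))) hF
          rintro _ ⟨m, hm, rfl⟩
          refine Submodule.span_mono (Set.image_mono (Set.Ici_subset_Ioi.2 hm))
            (h.corner_mul_corner_le_span hd hdv hu hwu m ?_)
          rw [LinearMap.mulRight_apply, mul_assoc]
          exact Submodule.mul_mem_mul (hd m)
            (mul_mem_corner (hu m) (end_mem_corner hs.idem G)) }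
    have hW : (⨆ (i' : Λ) (_ : i < i'), Ideal.span {f i'}) ≤ W := by
      refine iSup₂_le fun m hm => (Ideal.span_singleton_le_iff_mem _).2 ?_
      change (f m (projGen e ⊥) : A) ∈ Submodule.span K ((fun m => d m * u m) '' Set.Ioi i)
      rw [hf]
      exact Submodule.subset_span ⟨m, hm, rfl⟩
    exact fun hF => hW hF
  · intro hF
    suffices key : ∀ z ∈ Submodule.span K ((fun m => d m * u m) '' Set.Ioi i),
        ∃ G ∈ (⨆ (i' : Λ) (_ : i < i'), Ideal.span {f i'}), (G (projGen e ⊥) : A) = z by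
      obtain ⟨G, hG, hGF⟩ := key _ hF
      rwa [← end_ext hs.idem hGF]
    intro z hz
    induction hz using Submodule.span_induction with
    | mem z hz =>
      obtain ⟨m, hm, rfl⟩ := hz
      exact ⟨f m, Submodule.mem_iSup_of_mem m (Submodule.mem_iSup_of_mem hm
        (Ideal.mem_span_singleton_self _)), hf m⟩
    | zero => exact ⟨0, Submodule.zero_mem _, rfl⟩
    | add _ _ _ _ h1 h2 =>
      obtain ⟨G, hG, rfl⟩ := h1
      obtain ⟨G', hG', rfl⟩ := h2
      exact ⟨G + G', Submodule.add_mem _ hG hG', rfl⟩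
    | smul c _ _ h1 =>
      obtain ⟨G, hG, rfl⟩ := h1
      refine ⟨projLift e ⊥ (c • projGen e ⊥) * G, Ideal.mul_mem_left _ _ hG, ?_⟩
      rw [mul_end_apply_projGen hs.idem]
      change _ * (e ⊥ * (c • e ⊥)) = _
      rw [mul_smul_comm, mul_smul_comm, (hs.idem.idem ⊥).eq, mul_e_of_mem_proj hs.idem (G _).2]

/-- Independence of the d_m u_m keeps f_i out of `T`. If G f_i is not in `T`, then G(e_⊥) is not in
r, so G has a left inverse and G f_i generates the whole ideal. -/
theorem isLocalModule_span (i : Λ) :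
    IsLocalModule (Module.End A (proj e (⊥ : Λ))) (Ideal.span {f i}) ∧
    (Module.jacobson (Module.End A (proj e (⊥ : Λ))) (Ideal.span {f i})).map
      (Ideal.span {f i}).subtype = ⨆ (i' : Λ) (_ : i < i'), Ideal.span {f i'} := by
  set T : Ideal (Module.End A (proj e (⊥ : Λ))) := ⨆ (i' : Λ) (_ : i < i'), Ideal.span {f i'}
    with hT
  have hTI : T ≤ Ideal.span {f i} :=
    iSup₂_le fun m hm => span_le_span hs h hd hdv hu hwu hf hm.le
  have hne : Submodule.comap (Ideal.span {f i}).subtype T ≠ ⊤ := by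
    intro ht
    have h1 : (⟨f i, Ideal.mem_span_singleton_self _⟩ : Ideal.span {f i}) ∈
      Submodule.comap (Ideal.span {f i}).subtype T := ht ▸ Submodule.mem_top
    have h2 : f i ∈ T := h1
    rw [hT, mem_iSup_span_iff hs h hd hdv hu hwu hf, hf] at h2
    exact (h.linearIndependent hd hdv hu hwu hs.idem).notMem_span_image Set.self_notMem_Ioi h2
  have hmax : ∀ L : Submodule (Module.End A (proj e (⊥ : Λ))) (Ideal.span {f i}),
      L ≤ Submodule.comap (Ideal.span {f i}).subtype T ∨ L = ⊤ := by
    intro L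
    by_contra! hL
    obtain ⟨⟨F, hFI⟩, hFL, hF⟩ := Set.not_subset.1 hL.1
    have hF : F ∉ T := hF
    obtain ⟨G, rfl⟩ := Ideal.mem_span_singleton'.1 hFI
    have hG := end_mem_corner (K := K) hs.idem G
    obtain ⟨c, hc⟩ := hs.sub_smul_mem (G (projGen e ⊥)).2
    have hc0 : c ≠ 0 := by
      rintro rfl
      rw [zero_smul, sub_zero] at hc
      refine hF ?_
      rw [hT, mem_iSup_span_iff hs h hd hdv hu hwu hf, mul_end_apply_projGen hs.idem, hf]
      exact h.mul_mem_span_Ioi hd hdv hu hwu i hG (hs.nilpotent _ hc)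
    obtain ⟨t, ht⟩ := (hs.isUnit_smul_one_add hc0 hc).exists_right_inv
    let H : Module.End A (proj e (⊥ : Λ)) := projLift e ⊥ (t • projGen e ⊥)
    have hHG : H * G = 1 := by
      refine end_ext hs.idem ?_
      rw [mul_end_apply_projGen hs.idem]
      change (G (projGen e ⊥) : A) * (e ⊥ * (t * e ⊥)) = e ⊥
      rw [← mul_assoc, hG.2, ← mul_assoc]
      have h1 := congrArg (fun z => e ⊥ * z * e ⊥) ht
      simp only [mul_one, (hs.idem.idem ⊥).eq] at h1
      refine Eq.trans ?_ h1
      rw [← mul_assoc (e ⊥), mul_add, mul_sub, hG.1, mul_smul_comm, mul_smul_comm, mul_one,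
        (hs.idem.idem ⊥).eq, add_sub_cancel]
    refine hL.2 ((Submodule.eq_top_iff').2 ?_)
    rintro ⟨F', hF'⟩
    obtain ⟨G', rfl⟩ := Ideal.mem_span_singleton'.1 hF'
    have h2 := L.smul_mem (G' * H) hFL
    have h3 : (G' * H) • (⟨G * f i, hFI⟩ : Ideal.span {f i}) = ⟨G' * f i, hF'⟩ := by
      refine Subtype.ext ?_
      change G' * H * (G * f i) = G' * f i
      rw [mul_assoc, ← mul_assoc H, hHG, one_mul]
    rwa [h3] at h2
  refine ⟨isLocalModule_of_forall_le_or_eq_top hne hmax, ?_⟩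
  rw [jacobson_eq_of_forall_le_or_eq_top hne hmax, Submodule.map_comap_subtype]
  exact inf_eq_right.2 hTI

/-- The i-th component sends y to right multiplication by d_i y. Left multiplication by d_i commutes
with B, and P(⊥) is the sum of the e_iAe_⊥, on each of which d_i acts injectively. -/
theorem nonempty_linearEquiv :
    Nonempty (proj e (⊥ : Λ) ≃ₗ[Module.End A (proj e (⊥ : Λ))]
      ⨁ i : Λ, ↥(Ideal.span {f i} : Ideal (Module.End A (proj e (⊥ : Λ))))) := by
  classical
  have hR : ∀ (i : Λ) (y : proj e (⊥ : Λ)),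
      (projLift e ⊥ (d i • y) (projGen e ⊥) : A) = d i * (y : A) := by
    intro i y
    change e ⊥ * (d i * (y : A)) = d i * (y : A)
    rw [← mul_assoc, (hd i).1]
  have hmem : ∀ (i : Λ) (y : proj e (⊥ : Λ)), projLift e ⊥ (d i • y) ∈ Ideal.span {f i} := by
    intro i y
    rw [mem_span_iff hs h hd hdv hu hwu hf, ← h.map_mulLeft_corner hd hdv hu hwu i, hR]
    refine ⟨_, e_mul_mem_corner hs.idem i y.2, ?_⟩
    rw [LinearMap.mulLeft_apply, ← mul_assoc, (hd i).2]
  let φ : proj e (⊥ : Λ) →ₗ[Module.End A (proj e (⊥ : Λ))]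
      ∀ i : Λ, ↥(Ideal.span {f i} : Ideal (Module.End A (proj e (⊥ : Λ)))) :=
    LinearMap.pi fun i =>
      { toFun := fun y => ⟨projLift e ⊥ (d i • y), hmem i y⟩
        map_add' := fun y z => Subtype.ext (LinearMap.ext fun a => by
          change (a : A) • d i • (y + z) = (a : A) • d i • y + (a : A) • d i • z
          rw [smul_add, smul_add])
        map_smul' := fun b y => Subtype.ext (LinearMap.ext fun a => by
          change (a : A) • d i • b y = b ((a : A) • d i • y)
          rw [map_smul, map_smul]) }
  have hφ : ∀ (y : proj e (⊥ : Λ)) (i : Λ),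
      ((φ y i : Module.End A (proj e (⊥ : Λ))) (projGen e ⊥) : A) = d i * (y : A) :=
    fun y i => hR i y
  refine ⟨(LinearEquiv.ofBijective φ ⟨?_, ?_⟩).trans
    (DirectSum.linearEquivFunOnFintype _ _ _).symm⟩
  · refine (injective_iff_map_eq_zero φ).2 fun y hy => Subtype.ext ?_
    have h1 : ∀ i, e i * (y : A) = 0 := by
      intro i
      refine h.eq_zero_of_mul_eq_zero (hd i) (hdv i) (by rw [← mul_assoc, hs.idem.idem i]) ?_
      rw [← mul_assoc, (hd i).2, ← hφ, hy]
      rfl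
    change (y : A) = 0
    rw [← one_mul (y : A), ← hs.idem.complete, Finset.sum_mul]
    exact Finset.sum_eq_zero fun i _ => h1 i
  · intro F
    choose G hG using fun i => Ideal.mem_span_singleton'.1 (F i).2
    let u' : Λ → proj e (⊥ : Λ) := fun i => ⟨u i, mem_proj_of_mem_corner (hu i)⟩
    -- With F_i = G_i f_i, orthogonality of the idempotents leaves only the term d_j u_j G_j(e_⊥) in
    -- component j.
    refine ⟨∑ i, G i (u' i), funext fun j => Subtype.ext (end_ext hs.idem ?_)⟩
    rw [hφ, ← hG, mul_end_apply_projGen hs.idem, hf]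
    have h1 : ∀ i, (G i (u' i) : A) = u i * (G i (projGen e ⊥) : A) :=
      fun i => coe_end_apply hs.idem (G i) (u' i)
    rw [AddSubmonoidClass.coe_finsetSum, Finset.mul_sum, Finset.sum_eq_single j _ (by simp), h1,
      mul_assoc]
    intro i _ hij
    rw [h1, ← (hd j).2, ← (hu i).1, ← mul_assoc, ← mul_assoc, mul_assoc (d j),
      hs.idem.ortho hij.symm, mul_zero, zero_mul, zero_mul]

end PeakIdeals

/-! ### The radical of a bound quiver algebra -/

namespace Presentation

variable {K : Type u} [Field K] {A : Type v} [Ring A] [Algebra K A] {Λ : Type x} [Fintype Λ]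
  (D : Presentation.{u, v, w, x} K A Λ)

theorem e_mul_value {i j : Λ} (p : D.Path i j) : D.e j * D.value p = D.value p := by
  cases p with
  | nil => exact D.idem.idem i
  | cons p a =>
    change D.e j * (D.arr _ _ a * D.value p) = D.arr _ _ a * D.value p
    rw [← D.arr_mem, ← mul_assoc, ← mul_assoc, ← mul_assoc, D.idem.idem j]

theorem value_mem_corner {i j : Λ} (p : D.Path i j) : D.value p ∈ corner K D.e j i :=
  ⟨D.e_mul_value p, D.value_mul_e p⟩

theorem arr_mem_corner {i j : Λ} (a : D.quiver.Hom i j) : D.arr i j a ∈ corner K D.e j i := by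
  rw [← D.arr_mem i j a]
  exact mul_mul_mem_corner D.idem j i _

theorem value_comp {i j k : Λ} (p : D.Path i j) (q : D.Path j k) :
    D.value (@Quiver.Path.comp Λ D.quiver i j k p q) = D.value q * D.value p := by
  induction q with
  | nil => exact (D.e_mul_value p).symm
  | cons q a ih =>
    change D.arr _ _ a * D.value (@Quiver.Path.comp Λ D.quiver i j _ p q) =
      D.arr _ _ a * D.value q * D.value p
    rw [ih, mul_assoc]

/-- The length of a path. -/
def len {i j : Λ} (p : D.Path i j) : ℕ := @Quiver.Path.length Λ D.quiver i j p

/-- The span of the paths of length at least `m`. -/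
def pathSpan (m : ℕ) : Submodule K A :=
  Submodule.span K {a | ∃ (i j : Λ) (p : D.Path i j), m ≤ D.len p ∧ D.value p = a}

theorem value_mem_pathSpan {m : ℕ} {i j : Λ} (p : D.Path i j) (hp : m ≤ D.len p) :
    D.value p ∈ D.pathSpan m :=
  Submodule.subset_span ⟨i, j, p, hp, rfl⟩

theorem pathSpan_zero : D.pathSpan 0 = ⊤ := by
  refine eq_top_iff.2 fun a _ => ?_
  obtain ⟨y, rfl⟩ := D.surjective a
  rw [pathMap, Finsupp.linearCombination_apply]
  exact Submodule.sum_mem _ fun p _ =>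
    Submodule.smul_mem _ _ (D.value_mem_pathSpan p.2.2 (Nat.zero_le _))

theorem pathSpan_mul_le (m n : ℕ) : D.pathSpan m * D.pathSpan n ≤ D.pathSpan (m + n) := by
  rw [pathSpan, pathSpan, Submodule.span_mul_span, Submodule.span_le]
  rintro _ ⟨_, ⟨i, j, p, hp, rfl⟩, _, ⟨k, l, q, hq, rfl⟩, rfl⟩
  change D.value p * D.value q ∈ D.pathSpan (m + n)
  by_cases hil : l = i
  · subst hil
    rw [← D.value_comp]
    refine D.value_mem_pathSpan _ ?_
    have : D.len (@Quiver.Path.comp Λ D.quiver k l j q p) = D.len q + D.len p :=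
      @Quiver.Path.length_comp Λ D.quiver k l q j p
    omega
  · rw [← D.value_mul_e p, ← D.e_mul_value q, mul_assoc, ← mul_assoc (D.e i),
      D.idem.ortho (Ne.symm hil), zero_mul, mul_zero]
    exact Submodule.zero_mem _

theorem pathSpan_one_pow_le (m : ℕ) : D.pathSpan 1 ^ m ≤ D.pathSpan m := by
  induction m with
  | zero => rw [D.pathSpan_zero]; exact le_top
  | succ m ih =>
    rw [pow_succ]
    exact (mul_le_mul_left ih _).trans (D.pathSpan_mul_le m 1)

/-- A path of length at most one is not a combination of longer paths. -/
theorem value_notMem_pathSpan {i j : Λ} (p : D.Path i j) (hp : D.len p ≤ 1) :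
    D.value p ∉ D.pathSpan (D.len p + 1) := by
  classical
  intro h
  have h1 : D.pathSpan (D.len p + 1) ≤
      (Finsupp.supported K K {q : AllPaths D.quiver | D.len p + 1 ≤ D.len q.2.2}).map
        (pathMap K D.quiver D.e D.arr) := by
    refine Submodule.span_le.2 ?_
    rintro _ ⟨k, l, q, hq, rfl⟩
    refine ⟨Finsupp.single ⟨k, l, q⟩ 1, Finsupp.single_mem_supported K 1 hq, ?_⟩
    rw [pathMap, Finsupp.linearCombination_single, one_smul]
    rfl
  obtain ⟨y, hy, hyp⟩ := h1 h
  -- The difference is a relation with coefficient 1 at p, since y involves only longer paths;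
  -- relations live in length at least 2.
  have h2 : Finsupp.single (⟨i, j, p⟩ : AllPaths D.quiver) (1 : K) - y ∈
      LinearMap.ker (pathMap K D.quiver D.e D.arr) := by
    rw [LinearMap.mem_ker, map_sub, hyp, pathMap, Finsupp.linearCombination_single, one_smul]
    exact sub_self _
  have h3 := D.ker_le h2
  have h4 : y ⟨i, j, p⟩ = 0 := by
    by_contra hne
    have : D.len p + 1 ≤ D.len p := hy (Finsupp.mem_support_iff.2 hne)
    omega
  have h5 : (⟨i, j, p⟩ : AllPaths D.quiver) ∈
      (Finsupp.single (⟨i, j, p⟩ : AllPaths D.quiver) (1 : K) - y).support := by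
    rw [Finsupp.mem_support_iff, Finsupp.sub_apply, Finsupp.single_eq_same, h4, sub_zero]
    exact one_ne_zero
  have h6 : 2 ≤ D.len p := h3 h5
  omega

theorem exists_sub_mem_pathSpan (i : Λ) (a : A) :
    ∃ c : K, D.e i * a * D.e i - c • D.e i ∈ D.pathSpan 1 := by
  have ha : a ∈ D.pathSpan 0 := D.pathSpan_zero ▸ Submodule.mem_top
  induction ha using Submodule.span_induction with
  | mem a ha =>
    obtain ⟨k, l, p, -, rfl⟩ := ha
    cases p with
    | nil =>
      change ∃ c : K, D.e i * D.e k * D.e i - c • D.e i ∈ D.pathSpan 1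
      by_cases hik : i = k
      · refine ⟨1, ?_⟩
        rw [← hik, (D.idem.idem i).eq, (D.idem.idem i).eq, one_smul, sub_self]
        exact Submodule.zero_mem _
      · refine ⟨0, ?_⟩
        rw [D.idem.ortho hik, zero_mul, zero_smul, sub_self]
        exact Submodule.zero_mem _
    | cons q a =>
      refine ⟨0, ?_⟩
      rw [zero_smul, sub_zero]
      have h1 : D.value (@Quiver.Path.cons Λ D.quiver _ _ _ q a) ∈ D.pathSpan 1 :=
        D.value_mem_pathSpan _ (Nat.le_add_left 1 _)
      have h2 := D.pathSpan_mul_le 0 1 (Submodule.mul_mem_mul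
        (D.pathSpan_zero ▸ Submodule.mem_top : D.e i ∈ D.pathSpan 0) h1)
      exact D.pathSpan_mul_le 1 0 (Submodule.mul_mem_mul h2
        (D.pathSpan_zero ▸ Submodule.mem_top : D.e i ∈ D.pathSpan 0))
  | zero => exact ⟨0, by simp⟩
  | add a b _ _ h1 h2 =>
    obtain ⟨c, hc⟩ := h1
    obtain ⟨c', hc'⟩ := h2
    refine ⟨c + c', ?_⟩
    convert Submodule.add_mem _ hc hc' using 1
    rw [mul_add, add_mul, add_smul]
    abel
  | smul b a _ h1 =>
    obtain ⟨c, hc⟩ := h1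
    refine ⟨b * c, ?_⟩
    convert Submodule.smul_mem _ b hc using 1
    rw [smul_sub, mul_smul_comm, smul_mul_assoc, mul_smul]

theorem e_mul_mul_e_mem_pathSpan {i j : Λ} (hij : i ≠ j) (a : A) :
    D.e i * a * D.e j ∈ D.pathSpan 1 := by
  have ha : a ∈ D.pathSpan 0 := D.pathSpan_zero ▸ Submodule.mem_top
  induction ha using Submodule.span_induction with
  | mem a ha =>
    obtain ⟨k, l, p, -, rfl⟩ := ha
    by_cases hl : i = l
    · by_cases hk : k = j
      · subst hl hk
        rw [D.e_mul_value, D.value_mul_e]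
        refine D.value_mem_pathSpan _ ?_
        cases p with
        | nil => exact absurd rfl hij
        | cons q a => exact Nat.le_add_left 1 _
      · rw [← D.value_mul_e p, mul_assoc, mul_assoc, D.idem.ortho hk, mul_zero, mul_zero]
        exact Submodule.zero_mem _
    · rw [← D.e_mul_value p, ← mul_assoc, D.idem.ortho hl, zero_mul, zero_mul]
      exact Submodule.zero_mem _
  | zero => simp
  | add a b _ _ h1 h2 =>
    rw [mul_add, add_mul]
    exact Submodule.add_mem _ h1 h2
  | smul b a _ h1 =>
    rw [mul_smul_comm, smul_mul_assoc]
    exact Submodule.smul_mem _ _ h1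

theorem isSplitBasic : IsSplitBasic D.e (D.pathSpan 1) where
  idem := D.idem
  mul_left := fun a y hy => by
    have := D.pathSpan_mul_le 0 1 (Submodule.mul_mem_mul
      (D.pathSpan_zero ▸ Submodule.mem_top : a ∈ D.pathSpan 0) hy)
    exact this
  mul_right := fun a y hy => D.pathSpan_mul_le 1 0 (Submodule.mul_mem_mul hy
    (D.pathSpan_zero ▸ Submodule.mem_top : a ∈ D.pathSpan 0))
  nilpotent := fun y hy => by
    obtain ⟨m, hm⟩ := D.nilpotent
    refine ⟨m, ?_⟩
    have h1 := D.pathSpan_one_pow_le m (Submodule.pow_mem_pow _ hy m)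
    refine (Submodule.mem_bot K).1 ((Submodule.span_le.2 ?_ : D.pathSpan m ≤ ⊥) h1)
    rintro _ ⟨i, j, p, hp, rfl⟩
    exact hm ⟨i, j, p⟩ hp
  diag := D.exists_sub_mem_pathSpan
  off_diag := fun _ _ a hij => D.e_mul_mul_e_mem_pathSpan hij a
  notMem := fun i => D.value_notMem_pathSpan (@Quiver.Path.nil Λ D.quiver i) (Nat.zero_le 1)

theorem arr_notMem_pathSpan {i j : Λ} (a : D.quiver.Hom i j) : D.arr i j a ∉ D.pathSpan 2 := by
  intro h
  refine D.value_notMem_pathSpan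
    (@Quiver.Path.cons Λ D.quiver _ _ _ (@Quiver.Path.nil Λ D.quiver i) a) le_rfl ?_
  have h1 := (D.arr_mem_corner a).2
  have h2 : D.value (@Quiver.Path.cons Λ D.quiver _ _ _ (@Quiver.Path.nil Λ D.quiver i) a) =
    D.arr i j a * D.e i := rfl
  rw [h2, h1]
  exact h

/-! ### Ascending and descending paths -/

variable [PartialOrder Λ] [BoundedOrder Λ] {v w : Λ → A}

omit [BoundedOrder Λ] in
-- A vertex m > l differs from both b and c, so both factors of a product through m lie in the
-- radical.
theorem iSup_corner_le_pathSpan {b c l : Λ} (hb : b ≤ l) (hc : c ≤ l) :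
    (⨆ (m : Λ) (_ : l < m), corner K D.e c m * corner K D.e m b) ≤ D.pathSpan 2 := by
  refine iSup₂_le fun m hm => (Submodule.mul_le.2 fun y hy z hz => ?_)
  refine D.pathSpan_mul_le 1 1 (Submodule.mul_mem_mul ?_ ?_)
  · rw [← hy.2, ← hy.1]
    exact D.e_mul_mul_e_mem_pathSpan (hc.trans_lt hm).ne _
  · rw [← hz.2, ← hz.1]
    exact D.e_mul_mul_e_mem_pathSpan (hb.trans_lt hm).ne' _

/-- If c ≤ b, an arrow killing v_b would factor through vertices above b and hence lie in the square
of the radical, which contains no arrow. -/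
theorem arr_mul_v_ne_zero_iff (h : IsPeakSystem K D.e v w) {b c : Λ} (a : D.quiver.Hom b c) :
    D.arr b c a * v b ≠ 0 ↔ c ≤ b := by
  constructor
  · intro h0
    by_contra hcb
    exact h0 (h.mul_v_eq_zero hcb (D.arr_mem_corner a))
  · intro hcb h0
    exact D.arr_notMem_pathSpan a
      (D.iSup_corner_le_pathSpan le_rfl hcb (h.mem_of_mul_v (D.arr_mem_corner a) h0))

theorem w_mul_arr_ne_zero_iff (h : IsPeakSystem K D.e v w) {b c : Λ} (a : D.quiver.Hom b c) :
    w c * D.arr b c a ≠ 0 ↔ b ≤ c := by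
  constructor
  · intro h0
    by_contra hcb
    exact h0 (h.w_mul_eq_zero hcb (D.arr_mem_corner a))
  · intro hcb h0
    exact D.arr_notMem_pathSpan a
      (D.iSup_corner_le_pathSpan hcb le_rfl (h.mem_of_w_mul (D.arr_mem_corner a) h0))

/-- Each arrow maps one line e_bAe_⊤ to another, so the product is nonzero exactly when no single
arrow kills its line. -/
theorem value_mul_v_ne_zero_iff (h : IsPeakSystem K D.e v w) {i j : Λ} (p : D.Path i j) :
    D.value p * v i ≠ 0 ↔ IsDescending D.quiver p := by
  induction p with
  | nil =>
    refine ⟨fun _ => trivial, fun _ => ?_⟩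
    change D.e i * v i ≠ 0
    rw [(h.v_mem i).1]
    exact h.v_ne_zero i
  | @cons b c p a ih =>
    change D.arr b c a * D.value p * v i ≠ 0 ↔ IsDescending D.quiver p ∧ c ≤ b
    obtain ⟨s, hs⟩ := h.exists_eq_smul_v (mul_mem_corner (D.value_mem_corner p) (h.v_mem i))
    rw [← ih, mul_assoc, hs, mul_smul_comm, smul_ne_zero_iff, smul_ne_zero_iff,
      D.arr_mul_v_ne_zero_iff h]
    simp [h.v_ne_zero]

theorem w_mul_value_ne_zero_iff (h : IsPeakSystem K D.e v w) {i j : Λ} (p : D.Path i j) :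
    w j * D.value p ≠ 0 ↔ IsAscending D.quiver p := by
  induction p with
  | nil =>
    refine ⟨fun _ => trivial, fun _ => ?_⟩
    change w i * D.e i ≠ 0
    rw [(h.w_mem i).2]
    exact h.w_ne_zero i
  | @cons b c p a ih =>
    change w c * (D.arr b c a * D.value p) ≠ 0 ↔ IsAscending D.quiver p ∧ b ≤ c
    obtain ⟨s, hs⟩ := h.exists_eq_smul_w (mul_mem_corner (h.w_mem c) (D.arr_mem_corner a))
    rw [← ih, ← D.w_mul_arr_ne_zero_iff h, ← mul_assoc, hs, smul_mul_assoc, smul_ne_zero_iff,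
      smul_ne_zero_iff, and_comm]
    simp [h.w_ne_zero]

omit [PartialOrder Λ] [BoundedOrder Λ] in
theorem exists_path_of_ne_zero (φ : A →ₗ[K] A) {i j : Λ} {a : A} (ha : φ (D.e j * a * D.e i) ≠ 0) :
    ∃ p : D.Path i j, φ (D.value p) ≠ 0 := by
  by_contra! hc
  refine ha ?_
  have h0 : a ∈ D.pathSpan 0 := D.pathSpan_zero ▸ Submodule.mem_top
  clear ha
  induction h0 using Submodule.span_induction with
  | mem a ha =>
    obtain ⟨k, l, p, -, rfl⟩ := ha
    by_cases hl : j = l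
    · by_cases hk : k = i
      · subst hl hk
        rw [D.e_mul_value, D.value_mul_e, hc]
      · rw [← D.value_mul_e p, mul_assoc, mul_assoc, D.idem.ortho hk, mul_zero, mul_zero, map_zero]
    · rw [← D.e_mul_value p, ← mul_assoc, D.idem.ortho hl, zero_mul, zero_mul, map_zero]
  | zero => simp
  | add a b _ _ h1 h2 => rw [mul_add, add_mul, map_add, h1, h2, add_zero]
  | smul b a _ h1 => rw [mul_smul_comm, smul_mul_assoc, map_smul, h1, smul_zero]

/-- Some a satisfies a v_i = v_⊥ w_⊤ ≠ 0. Expanding a in paths, some path from i to ⊥ does not kill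
v_i, and such a path is descending. -/
theorem exists_isDescending (h : IsPeakSystem K D.e v w) (i : Λ) :
    ∃ q : D.Path i ⊥, IsDescending D.quiver q := by
  obtain ⟨a, ha⟩ := h.exists_mul_eq (h.v_mem i).2 (h.v_ne_zero i)
  obtain ⟨q, hq⟩ := D.exists_path_of_ne_zero (LinearMap.mulRight K (v i)) (i := i) (j := ⊥)
    (a := a) (by
      rw [LinearMap.mulRight_apply, mul_assoc, (h.v_mem i).1, mul_assoc, ha, ← mul_assoc,
        (h.v_mem ⊥).1]
      exact h.v_mul_w_ne_zero _ _)
  exact ⟨q, (D.value_mul_v_ne_zero_iff h q).1 hq⟩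

theorem exists_isAscending (h : IsPeakSystem K D.e v w) (i : Λ) :
    ∃ p : D.Path ⊥ i, IsAscending D.quiver p := by
  obtain ⟨a, ha⟩ := h.exists_eq_mul (h.w_mem i).1 (h.w_ne_zero i)
  obtain ⟨q, hq⟩ := D.exists_path_of_ne_zero (LinearMap.mulLeft K (w i)) (i := ⊥) (j := i)
    (a := a) (by
      rw [LinearMap.mulLeft_apply, ← mul_assoc, ← mul_assoc, (h.w_mem i).2, ha, mul_assoc,
        (h.w_mem ⊥).2]
      exact h.v_mul_w_ne_zero _ _)
  exact ⟨q, (D.w_mul_value_ne_zero_iff h q).1 hq⟩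

end Presentation
end OneQH

theorem mainTheorem6 {K : Type*} [Field K] [IsAlgClosed K]
    {A : Type*} [Ring A] [Algebra K A] [FiniteDimensional K A]
    {Λ : Type*} [Fintype Λ] [PartialOrder Λ] [BoundedOrder Λ]
    (D : OneQH.Presentation K A Λ) (hA : OneQH.IsOneQuasiHereditary K D.e) :
    (∀ i : Λ, ∃ c : D.Path ⊥ ⊥, D.IsPeakPath ⊥ i ⊥ c) ∧
    ∀ c : Λ → D.Path ⊥ ⊥, (∀ i : Λ, D.IsPeakPath ⊥ i ⊥ (c i)) →
      Nonempty (↥(OneQH.proj D.e ⊥) ≃ₗ[D.EndAlg ⊥] ⨁ i : Λ, ↥(D.pathIdeal (c i))) ∧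
      ∀ i : Λ,
        (D.pathIdeal (c i)).IsTwoSided ∧
        OneQH.IsLocalModule (D.EndAlg ⊥) ↥(D.pathIdeal (c i)) ∧
        (Module.jacobson (D.EndAlg ⊥) ↥(D.pathIdeal (c i))).map (D.pathIdeal (c i)).subtype =
          ⨆ (i' : Λ) (_ : i < i'), D.pathIdeal (c i') := by
  have hs := D.isSplitBasic
  obtain ⟨v, w, h⟩ := OneQH.exists_isPeakSystem hs hA
  refine ⟨fun i => ?_, fun c hc => ?_⟩
  · obtain ⟨p, hp⟩ := D.exists_isAscending h i
    obtain ⟨q, hq⟩ := D.exists_isDescending h i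
    exact ⟨_, p, q, hp, hq, rfl⟩
  · choose p q hp hq hpq using hc
    -- Products run from right to left, so the descending half q gives the left factor d_i and the
    -- ascending half p the right factor u_i.
    have hd : ∀ i, D.value (q i) ∈ OneQH.corner K D.e ⊥ i := fun i => D.value_mem_corner (q i)
    have hu : ∀ i, D.value (p i) ∈ OneQH.corner K D.e i ⊥ := fun i => D.value_mem_corner (p i)
    have hdv := fun i => (D.value_mul_v_ne_zero_iff h (q i)).2 (hq i)
    have hwu := fun i => (D.w_mul_value_ne_zero_iff h (p i)).2 (hp i)
    have hf : ∀ i, ((D.pathHom (c i) : D.EndAlg ⊥) (OneQH.projGen D.e ⊥) : A) =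
        D.value (q i) * D.value (p i) := by
      intro i
      change D.e ⊥ * D.value (c i) = _
      rw [D.e_mul_value, hpq, D.value_comp]
    exact ⟨OneQH.nonempty_linearEquiv hs h hd hdv hu hwu hf, fun i =>
      ⟨OneQH.isTwoSided_span hs h hd hdv hu hwu hf i,
        OneQH.isLocalModule_span hs h hd hdv hu hwu hf i⟩⟩
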